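/- Let $d\in\{2,3\}$, let $\Omega\subset\mathbb R^d$ be a bounded polyhedral domain with a conforming (face-to-face) simplicial mesh $\mathcal T_h$, with set of facets $\mathcal E=\mathcal E_I\cup\mathcal E_D\cup\mathcal E_N$ (interior, Dirichlet and Neumann facets; $\mathcal E_D\neq\emptyset$), and let $\Gamma_N=\bigcup_{F\in\mathcal E_N}F$. Let $A$ be a symmetric positive definite matrix coefficient, constant on each element, $f\in L^2(\Omega)$ and $g\in L^2(\Gamma_N)$. For each $F\in\mathcal E$ let $h_F$ be its diameter and $\mathbf n_F$ a unit normal, outward if $F\subset\partial\Omega$; $K_F^-$ is the element with outward normal $\mathbf n_F$ on $F$, and $K_F^+$ is the other element containing $F$ if $F\in\mathcal E_I$. Put $\llbracket v\rrbracket_F=v|_{K_F^-}-v|_{K_F^+}$ for $F\in\mathcal E_I$ and $\llbracket v\rrbracket_F=v|_{K_F^-}$ for boundary facets. Let $\alpha_F^\pm$ be the maximal eigenvalue of $A|_{K_F^\pm}$; $A_F=\min(\alpha_F^+,\alpha_F^-)$ for $F\in\mathcal E_I$ and $A_F=\alpha_F^-$ for $F\in\mathcal E_D$; and $\{v\}_w^F=\frac{\alpha_F^-}{\alpha_F^-+\alpha_F^+}v|_{K_F^+}+\frac{\alpha_F^+}{\alpha_F^-+\alpha_F^+}v|_{K_F^-}$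 for $F\in\mathcal E_I$, $\{v\}_w^F=v|_{K_F^-}$ for boundary facets. Let $DG(\mathcal T_h,k)$ be the space of piecewise polynomials of degree at most $k$, let $RT(\mathcal T_h,k)=\{\tau\in H(\mathrm{div};\Omega):\tau|_K\in \mathbb P_k(K)^d+x\,\mathbb P_k(K)\ \forall K\in\mathcal T_h\}$, and let $CG_{0,\Gamma_D}(\mathcal T_h,k)$ be the space of those $v\in H^1(\Omega)\cap DG(\mathcal T_h,k)$ that vanish on every $F\in\mathcal E_D$. Let $RT_f(\mathcal T_h,s)$ be the set of $\tau\in RT(\mathcal T_h,s)$ such that $\nabla\cdot\tau=f_s$ in $\Omega$ and $\tau\cdot\mathbf n_F=g_{s,F}$ on every $F\in\mathcal E_N$, where $f_s$ is the $L^2(\Omega)$-projection of $f$ onto $DG(\mathcal T_h,s)$ and $g_{s,F}$ is the $L^2(F)$-projection of $g|_F$ onto $\mathbb P_s(F)$. Let $k\ge1$ and $0\le s\le k-1$. Let $u_k^{cg}\in CG_{0,\Gamma_D}(\mathcal T_h,k)$ satisfy $(A\nabla u_k^{cg},\nabla v)=(f,v)-\langle g,v\rangle_{\Gamma_N}$ for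 all $v\in CG_{0,\Gamma_D}(\mathcal T_h,k)$. For $j\in\{s,k-1\}$ let $\tilde\sigma_j^{cg}\in RT(\mathcal T_h,j)$ be the averaging flux, defined by $$\int_F\tilde\sigma_j^{cg}\cdot\mathbf n_F\,\phi=-\int_F\{A\nabla u_k^{cg}\cdot\mathbf n_F\}_w^F\,\phi\quad(F\in\mathcal E\setminus\mathcal E_N),\qquad \int_F\tilde\sigma_j^{cg}\cdot\mathbf n_F\,\phi=\int_F g\,\phi\quad(F\in\mathcal E_N)$$ for all $\phi\in\mathbb P_j(F)$ and, if $j\ge1$, $(\tilde\sigma_j^{cg},\psi)_K=-(A\nabla u_k^{cg},\psi)_K$ for all $K\in\mathcal T_h$, $\psi\in\mathbb P_{j-1}(K)^d$. Let $u_s^\Delta\in DG(\mathcal T_h,s)$ (determined up to functions whose jumps vanish on $\mathcal E\setminus\mathcal E_N$) solve $$\sum_{F\in\mathcal E\setminus\mathcal E_N}\int_F A_Fh_F^{-1}\llbracket u_s^\Delta\rrbracket\llbracket v\rrbracket\,ds=(f-\nabla\cdot\tilde\sigma_{k-1}^{cg},v)\qquad\forall v\in DG(\mathcal T_h,s).$$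 For $w\in DG(\mathcal T_h,s)$ let $\mathbf S(w)\in RT(\mathcal T_h,s)$ be the flux with $\mathbf S(w)\cdot\mathbf n_F=A_Fh_F^{-1}\llbracket w\rrbracket$ on every $F\in\mathcal E\setminus\mathcal E_N$, $\mathbf S(w)\cdot\mathbf n_F=0$ on every $F\in\mathcal E_N$ and, if $s\ge1$, $(\mathbf S(w),\psi)_K=0$ for all $K\in\mathcal T_h$, $\psi\in\mathbb P_{s-1}(K)^d$. Then $\hat\sigma_s^{cg}:=\tilde\sigma_s^{cg}+\mathbf S(u_s^\Delta)$ lies in $RT_f(\mathcal T_h,s)$, and $$(\nabla\cdot\hat\sigma_s^{cg},v)=(f,v)\qquad\forall v\in DG(\mathcal T_h,s).$$ -/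

import Mathlib

open MeasureTheory
open scoped ContDiff

noncomputable section

namespace EARM

/-- Euclidean space `ℝᵈ`. -/
abbrev Eu (d : ℕ) := EuclideanSpace ℝ (Fin d)

/-- Real polynomials in `d` variables. -/
abbrev Poly (d : ℕ) := MvPolynomial (Fin d) ℝ

/-- Vector fields on `ℝᵈ` with polynomial components. -/
abbrev PolyVec (d : ℕ) := Fin d → Poly d

variable {d : ℕ}

/-! ### Polynomials as functions -/

/-- Value of a polynomial at a point. -/
def ev (p : Poly d) (x : Eu d) : ℝ := MvPolynomial.eval (fun i => x i) p

/-- Value of a polynomial vector field at a point. -/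
def evVec (τ : PolyVec d) (x : Eu d) : Eu d := WithLp.toLp 2 (fun i => ev (τ i) x)

/-- The gradient of a polynomial. -/
def grad (p : Poly d) : PolyVec d := fun i => MvPolynomial.pderiv i p

/-- A constant matrix applied to a polynomial vector field. -/
def matMul (A : Matrix (Fin d) (Fin d) ℝ) (τ : PolyVec d) : PolyVec d :=
  fun i => ∑ j, MvPolynomial.C (A i j) * τ j

/-- The local Raviart-Thomas space of index `k`: all `a + x b` with `a` in `(P_k)^d`, `b` in `P_k`. -/
def RTLocal (d k : ℕ) : Set (PolyVec d) :=
  {τ | ∃ (a : PolyVec d) (b : Poly d), (∀ i, (a i).totalDegree ≤ k) ∧ b.totalDegree ≤ k ∧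
    ∀ i, τ i = a i + MvPolynomial.X i * b}

/-! ### Weak derivatives on an open set -/

/-- Test functions: smooth functions with compact support inside `Ω`. -/
def IsTest (Ω : Set (Eu d)) (φ : Eu d → ℝ) : Prop :=
  ContDiff ℝ ∞ φ ∧ HasCompactSupport φ ∧ tsupport φ ⊆ Ω

/-- `q ∈ L²(Ω)` is the distributional divergence of `τ` in `Ω`. -/
def IsWeakDiv (Ω : Set (Eu d)) (τ : Eu d → Eu d) (q : Eu d → ℝ) : Prop :=
  MemLp q 2 (volume.restrict Ω) ∧
    ∀ φ, IsTest Ω φ → ∫ x in Ω, fderiv ℝ φ x (τ x) = -∫ x in Ω, q x * φ x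

/-- Membership in `H(div; Ω)`. -/
def MemHdiv (Ω : Set (Eu d)) (τ : Eu d → Eu d) : Prop :=
  MemLp τ 2 (volume.restrict Ω) ∧ ∃ q, IsWeakDiv Ω τ q

open Classical in
/-- The divergence of a field of `H(div; Ω)` (determined almost everywhere in `Ω`; zero for a field
without a divergence in `L²(Ω)`). -/
def weakDiv (Ω : Set (Eu d)) (τ : Eu d → Eu d) : Eu d → ℝ :=
  if h : ∃ q, IsWeakDiv Ω τ q then h.choose else 0

/-- Membership in the Sobolev space `H¹(Ω)`. -/
def MemH1 (Ω : Set (Eu d)) (v : Eu d → ℝ) : Prop :=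
  MemLp v 2 (volume.restrict Ω) ∧ ∃ G : Eu d → Eu d, MemLp G 2 (volume.restrict Ω) ∧
    ∀ φ, IsTest Ω φ → ∀ i : Fin d,
      ∫ x in Ω, v x * fderiv ℝ φ x (EuclideanSpace.single i 1) = -∫ x in Ω, G x i * φ x

/-! ### Meshes -/

/-- The closed simplex (or facet) with a given finite set of vertices. -/
def hull (K : Finset (Eu d)) : Set (Eu d) := convexHull ℝ (K : Set (Eu d))

/-- A finite element partition of `Ω`: finitely many nondegenerate `d`-simplices (given by their
vertices), any two of which meet in a common face or not at all, that fill `Ω`. -/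
structure Mesh (d : ℕ) (Ω : Set (Eu d)) where
  elems : Finset (Finset (Eu d))
  card_eq : ∀ K ∈ elems, K.card = d + 1
  indep : ∀ K ∈ elems, AffineIndependent ℝ (fun x : K => (x : Eu d))
  conforming : ∀ K ∈ elems, ∀ L ∈ elems,
    hull K ∩ hull L = convexHull ℝ ((K : Set (Eu d)) ∩ (L : Set (Eu d)))
  fills : Ω = interior (⋃ K ∈ elems, hull K)

variable {Ω : Set (Eu d)}

open Classical in
/-- The set of all facets, the `(d-1)`-dimensional faces of the elements. -/
def Mesh.facets (M : Mesh d Ω) : Finset (Finset (Eu d)) :=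
  M.elems.biUnion (fun K => K.powersetCard d)

/-- A facet is interior if it is shared by two elements. -/
def Mesh.IsInterior (M : Mesh d Ω) (F : M.facets) : Prop :=
  ∃ K L : M.elems, K ≠ L ∧ F.1 ⊆ K.1 ∧ F.1 ⊆ L.1

/-- `n` is the unit outward normal of the simplex `K` on its facet `F`. -/
def IsOuterNormal (K F : Finset (Eu d)) (n : Eu d) : Prop :=
  ‖n‖ = 1 ∧ (∀ x ∈ F, ∀ y ∈ F, inner ℝ n (x - y) = 0) ∧
    ∀ x ∈ F, ∀ z ∈ K, z ∉ F → inner ℝ n (z - x) < 0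

/-- A choice of unit normals of the facets, with the resulting elements `K_F^-` (the one whose
outward normal is `n_F`) and `K_F^+` (the other one; it is meaningful for interior facets only),
and a splitting of the boundary facets into Dirichlet and Neumann facets. -/
structure Skeleton (M : Mesh d Ω) where
  normal : M.facets → Eu d
  minus : M.facets → M.elems
  plus : M.facets → M.elems
  minus_sub : ∀ F, F.1 ⊆ (minus F).1
  minus_normal : ∀ F, IsOuterNormal (minus F).1 F.1 (normal F)
  plus_sub : ∀ F, M.IsInterior F → F.1 ⊆ (plus F).1 ∧ plus F ≠ minus F
  dirichlet : Finset M.facets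
  neumann : Finset M.facets
  disj : Disjoint dirichlet neumann
  boundary : ∀ F, (F ∈ dirichlet ∨ F ∈ neumann) ↔ ¬ M.IsInterior F

/-- Surface measure on a facet. -/
def facetMeasure (F : Finset (Eu d)) : Measure (Eu d) :=
  (Measure.euclideanHausdorffMeasure (d - 1)).restrict (hull F)

/-- The size `h_F` of a facet (its length if `d = 2`). -/
def hF (F : Finset (Eu d)) : ℝ := Metric.diam (hull F)

/-! ### Broken polynomial spaces

A piecewise polynomial function is the family of its restrictions to the elements. -/

/-- The function on `Ω` (defined up to the null set of element boundaries) with given restrictions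
to the elements. -/
def glue (M : Mesh d Ω) {β : Type*} [AddCommMonoid β] (v : M.elems → Eu d → β) : Eu d → β :=
  fun x => ∑ K : M.elems, (interior (hull K.1)).indicator (v K) x

/-- The scalar function on `Ω` of a piecewise polynomial. -/
def fn (M : Mesh d Ω) (v : M.elems → Poly d) : Eu d → ℝ := glue M (fun K => ev (v K))

/-- The vector field on `Ω` of a piecewise polynomial field. -/
def fnVec (M : Mesh d Ω) (τ : M.elems → PolyVec d) : Eu d → Eu d := glue M (fun K => evVec (τ K))

/-- `DG(T_h, k)`: discontinuous piecewise polynomials of degree at most `k`. -/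
def DG (M : Mesh d Ω) (k : ℕ) : Set (M.elems → Poly d) :=
  {v | ∀ K, (v K).totalDegree ≤ k}

/-- `RT(T_h, k)`: the `H(div; Ω)`-conforming Raviart-Thomas space. -/
def RT (M : Mesh d Ω) (k : ℕ) : Set (M.elems → PolyVec d) :=
  {τ | (∀ K, τ K ∈ RTLocal d k) ∧ MemHdiv Ω (fnVec M τ)}

variable {M : Mesh d Ω}

/-- The function on `F` that is the normal component `τ · n_F`, as a trace from `K_F^-`. -/
def normalTrace (S : Skeleton M) (τ : M.elems → PolyVec d) (F : M.facets) (x : Eu d) : ℝ :=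
  inner ℝ (evVec (τ (S.minus F)) x) (S.normal F)

/-- `CG_{0,Γ_D}(T_h, k)`: the `H¹(Ω)`-conforming piecewise polynomials of degree at most `k` that
vanish on the Dirichlet facets. -/
def CG0 (S : Skeleton M) (k : ℕ) : Set (M.elems → Poly d) :=
  {v | v ∈ DG M k ∧ MemH1 Ω (fn M v) ∧
    ∀ F ∈ S.dirichlet, ∀ x ∈ hull F.1, ev (v (S.minus F)) x = 0}

open Classical in
/-- The jump of a piecewise polynomial on a facet. -/
def jump (S : Skeleton M) (v : M.elems → Poly d) (F : M.facets) (x : Eu d) : ℝ :=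
  if M.IsInterior F then ev (v (S.minus F)) x - ev (v (S.plus F)) x else ev (v (S.minus F)) x

/-- The maximal eigenvalue of a matrix. -/
def maxEig (B : Matrix (Fin d) (Fin d) ℝ) : ℝ :=
  sSup {μ | Module.End.HasEigenvalue (Matrix.toLin' B) μ}

/-- `α_F^-`, for a piecewise constant coefficient `A`. -/
def alphaMinus (S : Skeleton M) (A : M.elems → Matrix (Fin d) (Fin d) ℝ) (F : M.facets) : ℝ :=
  maxEig (A (S.minus F))

/-- `α_F^+` (for interior facets). -/
def alphaPlus (S : Skeleton M) (A : M.elems → Matrix (Fin d) (Fin d) ℝ) (F : M.facets) : ℝ :=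
  maxEig (A (S.plus F))

open Classical in
/-- The facet coefficient `A_F`. -/
def AF (S : Skeleton M) (A : M.elems → Matrix (Fin d) (Fin d) ℝ) (F : M.facets) : ℝ :=
  if M.IsInterior F then min (alphaPlus S A F) (alphaMinus S A F) else alphaMinus S A F

open Classical in
/-- The weighted average `{A ∇u · n_F}_w^F`, with weights `ω_F^± = α_F^∓ / (α_F^- + α_F^+)` on
interior facets. -/
def avgFlux (S : Skeleton M) (A : M.elems → Matrix (Fin d) (Fin d) ℝ) (u : M.elems → Poly d)
    (F : M.facets) (x : Eu d) : ℝ :=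
  let side : M.elems → ℝ :=
    fun K => inner ℝ (evVec (matMul (A K) (grad (u K))) x) (S.normal F)
  if M.IsInterior F then
    alphaMinus S A F / (alphaMinus S A F + alphaPlus S A F) * side (S.plus F) +
      alphaPlus S A F / (alphaMinus S A F + alphaPlus S A F) * side (S.minus F)
  else side (S.minus F)

/-! ### The discrete problem, the averaging flux and the correction -/

/-- `u` is the conforming finite element solution of order `k`. -/
def IsCGSolution (S : Skeleton M) (A : M.elems → Matrix (Fin d) (Fin d) ℝ) (f g : Eu d → ℝ)
    (k : ℕ) (u : M.elems → Poly d) : Prop :=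
  u ∈ CG0 S k ∧ ∀ v ∈ CG0 S k,
    ∑ K : M.elems, ∫ x in hull K.1,
        inner ℝ (evVec (matMul (A K) (grad (u K))) x) (evVec (grad (v K)) x) =
      (∫ x in Ω, f x * fn M v x) -
        ∑ F ∈ S.neumann, ∫ x, g x * ev (v (S.minus F)) x ∂(facetMeasure F.1)

/-- `τ` is the averaging numerical flux of `u` in `RT(T_h, s)`. -/
def IsAveragingFlux (S : Skeleton M) (A : M.elems → Matrix (Fin d) (Fin d) ℝ) (g : Eu d → ℝ)
    (u : M.elems → Poly d) (s : ℕ) (τ : M.elems → PolyVec d) : Prop :=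
  τ ∈ RT M s ∧
  (∀ F, F ∉ S.neumann → ∀ φ : Poly d, φ.totalDegree ≤ s →
    ∫ x, normalTrace S τ F x * ev φ x ∂(facetMeasure F.1) =
      -∫ x, avgFlux S A u F x * ev φ x ∂(facetMeasure F.1)) ∧
  (∀ F ∈ S.neumann, ∀ φ : Poly d, φ.totalDegree ≤ s →
    ∫ x, normalTrace S τ F x * ev φ x ∂(facetMeasure F.1) =
      ∫ x, g x * ev φ x ∂(facetMeasure F.1)) ∧
  (1 ≤ s → ∀ K : M.elems, ∀ ψ : PolyVec d, (∀ i, (ψ i).totalDegree ≤ s - 1) →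
    ∫ x in hull K.1, inner ℝ (evVec (τ K) x) (evVec ψ x) =
      -∫ x in hull K.1, inner ℝ (evVec (matMul (A K) (grad (u K))) x) (evVec ψ x))

/-- The fluxes of `RT(T_h, s)` without interior moments (a void condition if `s = 0`) and with
vanishing normal component on the Neumann facets. -/
def RTo (S : Skeleton M) (s : ℕ) : Set (M.elems → PolyVec d) :=
  {τ | τ ∈ RT M s ∧
    (1 ≤ s → ∀ K : M.elems, ∀ ψ : PolyVec d, (∀ i, (ψ i).totalDegree ≤ s - 1) →
      ∫ x in hull K.1, inner ℝ (evVec (τ K) x) (evVec ψ x) = 0) ∧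
    ∀ F ∈ S.neumann, ∀ x ∈ hull F.1, normalTrace S τ F x = 0}

/-- `τ = S(w)`: the flux of `RTo` with normal component `A_F h_F⁻¹ ⟦w⟧` on all facets that are not
Neumann facets. -/
def IsJumpFlux (S : Skeleton M) (A : M.elems → Matrix (Fin d) (Fin d) ℝ) (s : ℕ)
    (w : M.elems → Poly d) (τ : M.elems → PolyVec d) : Prop :=
  τ ∈ RTo S s ∧ ∀ F, F ∉ S.neumann → ∀ x ∈ hull F.1,
    normalTrace S τ F x = AF S A F * (hF F.1)⁻¹ * jump S w F x

/-- The residual functional `r(v) = (f - ∇·σ, v)`. -/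
def residual (M : Mesh d Ω) (f : Eu d → ℝ) (σ : M.elems → PolyVec d) (v : M.elems → Poly d) : ℝ :=
  ∫ x in Ω, (f x - weakDiv Ω (fnVec M σ) x) * fn M v x

open Classical in
/-- The bilinear form `𝒜(⟦u⟧, ⟦v⟧)`. -/
def jumpForm (S : Skeleton M) (A : M.elems → Matrix (Fin d) (Fin d) ℝ)
    (u v : M.elems → Poly d) : ℝ :=
  ∑ F ∈ Finset.univ.filter (fun F : M.facets => F ∉ S.neumann),
    ∫ x, AF S A F * (hF F.1)⁻¹ * jump S u F x * jump S v F x ∂(facetMeasure F.1)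

/-- `u` (a representative modulo functions whose jumps vanish on all facets that are not Neumann
facets) solves the correction problem with the residual of `σ` on the right. -/
def IsCorrection (S : Skeleton M) (A : M.elems → Matrix (Fin d) (Fin d) ℝ) (f : Eu d → ℝ)
    (σ : M.elems → PolyVec d) (s : ℕ) (u : M.elems → Poly d) : Prop :=
  u ∈ DG M s ∧ ∀ v ∈ DG M s, jumpForm S A u v = residual M f σ v

/-! ### Equilibrated fluxes -/

/-- `p` is the `L²(Ω)`-projection of `f` onto `DG(T_h, s)`. -/
def IsProjDG (M : Mesh d Ω) (f : Eu d → ℝ) (s : ℕ) (p : M.elems → Poly d) : Prop :=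
  p ∈ DG M s ∧ ∀ v ∈ DG M s, ∫ x in Ω, fn M p x * fn M v x = ∫ x in Ω, f x * fn M v x

/-- The restriction of `q` to the facet `F` is the `L²(F)`-projection of `g` onto `P_s(F)`. -/
def IsProjFacet (F : Finset (Eu d)) (g : Eu d → ℝ) (s : ℕ) (q : Poly d) : Prop :=
  q.totalDegree ≤ s ∧ ∀ φ : Poly d, φ.totalDegree ≤ s →
    ∫ x, ev q x * ev φ x ∂(facetMeasure F) = ∫ x, g x * ev φ x ∂(facetMeasure F)

/-- `RT_f(T_h, s)`: fluxes with `∇·τ = f_s` in `Ω` and `τ · n_F = g_{s,F}` on Neumann facets. -/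
def RTf (S : Skeleton M) (f g : Eu d → ℝ) (s : ℕ) : Set (M.elems → PolyVec d) :=
  {τ | τ ∈ RT M s ∧
    (∃ p, IsProjDG M f s p ∧ weakDiv Ω (fnVec M τ) =ᵐ[volume.restrict Ω] fn M p) ∧
    ∀ F ∈ S.neumann, ∃ q, IsProjFacet F.1 g s q ∧ ∀ x ∈ hull F.1, normalTrace S τ F x = ev q x}

end EARM

end

set_option linter.unusedSectionVars false

/-! Everything rests on Green's formula for an RT field τ and a piecewise polynomial v: (∇·τ, v) =
-Σ_K (τ, ∇v)_K + Σ_F ∫_F τ·n_F ⟦v⟧ (`Skeleton.integral_weakDiv_mul`). If v has degree at most s,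
then ∇v has degree at most s - 1 and ⟦v⟧ degree at most s, so the right side involves only moments
of τ that define the fluxes.

Since s ≤ k - 1, the averaging fluxes of index s and k - 1 share these moments, hence have the same
divergence tested against v (`IsAveragingFlux.integral_weakDiv_eq`). For S(w) the volume and Neumann
terms vanish and the jump form remains (`IsJumpFlux.integral_weakDiv`); by the correction problem it
equals (f - ∇·σ̃_{k-1}, v). The two contributions add up to (f, v). As the divergence of an RT field
is piecewise of degree at most s, this identity says that it is the projection f_s. On Neumann
facets the correction has no normal component, and that of σ̃_s is a polynomial of degree at most s
with the moments of g.

Most of the work is Green's formula for the distributional divergence. The divergence theorem on a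
simplex (`integral_simplex_fderiv`) comes from slicing along edges. Test functions inside one
element identify the weak divergence with the elementwise one (`weakDiv_ae_eq`); test functions
around the relative interior of a facet give continuity of the normal component
(`Skeleton.normal_continuous`). Elementwise integration by parts can then be regrouped by facets. -/

noncomputable section

namespace EARM

/-! ### Oblique Fubini theorem for surface measure on a hyperplane -/

section Plane

variable {V : Type*} [NormedAddCommGroup V] [InnerProductSpace ℝ V]

theorem isometry_orthogonal_add (n p : V) : Isometry (fun y : (ℝ ∙ n)ᗮ => (y : V) + p) := by
  intro x y
  simp [edist_add_right, Subtype.edist_eq]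

variable [FiniteDimensional ℝ V] [MeasurableSpace V] [BorelSpace V]

/-- The surface measure on the hyperplane through `p` with normal `n`. -/
def planeMeasure (n p : V) : Measure V :=
  (Measure.euclideanHausdorffMeasure (Module.finrank ℝ V - 1)).restrict {x | inner ℝ n (x - p) = 0}

/-- Isometries preserve Hausdorff measure, and on n^⊥ the normalized Hausdorff measure is Lebesgue
measure. This transfers finiteness properties and Fubini from n^⊥ to the hyperplane. -/
theorem map_orthogonal_volume {n : V} (hn : ‖n‖ = 1) (p : V) :
    (volume : Measure (ℝ ∙ n)ᗮ).map (fun y : (ℝ ∙ n)ᗮ => (y : V) + p) = planeMeasure n p := by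
  have hn0 : n ≠ 0 := by rintro rfl; simp at hn
  have hr : Module.finrank ℝ (ℝ ∙ n)ᗮ = Module.finrank ℝ V - 1 := by
    have := (ℝ ∙ n).finrank_add_finrank_orthogonal
    rw [finrank_span_singleton hn0] at this
    omega
  rw [← InnerProductSpace.euclideanHausdorffMeasure_eq_volume,
    (isometry_orthogonal_add n p).map_euclideanHausdorffMeasure, hr, planeMeasure]
  congr 1
  ext x
  simp only [Set.mem_range, Set.mem_ofPred_eq]
  constructor
  · rintro ⟨y, rfl⟩
    have := Submodule.mem_orthogonal_singleton_iff_inner_right.1 y.2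
    simpa using this
  · intro h
    exact ⟨⟨x - p, Submodule.mem_orthogonal_singleton_iff_inner_right.2 h⟩, by simp⟩

theorem measurableEmbedding_orthogonal_add (n p : V) :
    MeasurableEmbedding (fun y : (ℝ ∙ n)ᗮ => (y : V) + p) :=
  (isometry_orthogonal_add n p).isClosedEmbedding.measurableEmbedding

theorem sigmaFinite_planeMeasure {n : V} (hn : ‖n‖ = 1) (p : V) :
    SigmaFinite (planeMeasure n p) := by
  rw [← map_orthogonal_volume hn p]
  exact (measurableEmbedding_orthogonal_add n p).sigmaFinite_map

theorem planeMeasure_isCompact_lt_top {n : V} (hn : ‖n‖ = 1) (p : V) {C : Set V}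
    (hC : IsCompact C) : planeMeasure n p C < ⊤ := by
  rw [← map_orthogonal_volume hn p, (measurableEmbedding_orthogonal_add n p).map_apply]
  exact ((isometry_orthogonal_add n p).isClosedEmbedding.isCompact_preimage hC).measure_lt_top

theorem lintegral_eq_lintegral_normal {n : V} (hn : ‖n‖ = 1) (p : V) {f : V → ENNReal}
    (hf : Measurable f) :
    ∫⁻ x, f x = ∫⁻ t : ℝ, ∫⁻ y : (ℝ ∙ n)ᗮ, f (t • n + y + p) := by
  let e := LinearIsometryEquiv.toSpanUnitSingleton (𝕜 := ℝ) n hn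
  have h1 := ((ℝ ∙ n).measurePreserving_measurableEquivProd p).symm
  have h2 : MeasurePreserving (Prod.map e (id : (ℝ ∙ n)ᗮ → (ℝ ∙ n)ᗮ)) (volume.prod volume)
    (volume.prod volume) := e.measurePreserving.prod (MeasurePreserving.id _)
  rw [← InnerProductSpace.euclideanHausdorffMeasure_eq_volume, ← h1.lintegral_comp hf,
    Measure.volume_eq_prod, ← h2.lintegral_comp (by fun_prop), lintegral_prod _ (by fun_prop)]
  simp [e]

/-- A shear reduces this to the orthogonal case: v = a n + w with w ⊥ n, where rescaling t produces
the factor |a| and, for fixed t, translation invariance on n^⊥ absorbs t w. -/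
theorem lintegral_eq_lintegral_plane {n : V} (hn : ‖n‖ = 1) (p : V) {v : V}
    (hv : inner ℝ n v ≠ 0) {f : V → ENNReal} (hf : Measurable f) :
    ∫⁻ x, f x = ENNReal.ofReal |inner ℝ n v| *
      ∫⁻ y, ∫⁻ t : ℝ, f (y + t • v) ∂volume ∂(planeMeasure n p) := by
  set a := inner ℝ n v with ha
  have hw : v - a • n ∈ (ℝ ∙ n)ᗮ := by
    rw [Submodule.mem_orthogonal_singleton_iff_inner_right, inner_sub_right, inner_smul_right,
      real_inner_self_eq_norm_sq, hn, ← ha]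
    ring
  have h1 : ∀ h : ℝ → ENNReal, Measurable h → ∫⁻ t, h t = ENNReal.ofReal |a| * ∫⁻ t, h (a * t) := by
    intro h hh
    rw [← lintegral_map (g := fun t => a * t) hh (by fun_prop), Real.map_volume_mul_left hv, lintegral_smul_measure,
      smul_eq_mul, ← mul_assoc, ← ENNReal.ofReal_mul (abs_nonneg _), ← abs_mul,
      mul_inv_cancel₀ hv]
    simp
  rw [lintegral_eq_lintegral_normal hn p hf, h1 _ (by fun_prop), ← map_orthogonal_volume hn p,
    (measurableEmbedding_orthogonal_add n p).lintegral_map]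
  congr 1
  conv_rhs => rw [lintegral_lintegral_swap (by fun_prop)]
  refine lintegral_congr fun t => ?_
  rw [← lintegral_add_right_eq_self _ (t • (⟨v - a • n, hw⟩ : (ℝ ∙ n)ᗮ))]
  refine lintegral_congr fun y => ?_
  congr 1
  simp only [Submodule.coe_add, Submodule.coe_smul, smul_sub, smul_smul, mul_comm t a]
  abel

/-- Stated for measures so that slicing passes from nonnegative functions to Bochner integrals. -/
theorem volume_eq_map_planeMeasure {n : V} (hn : ‖n‖ = 1) (p : V) {v : V}
    (hv : inner ℝ n v ≠ 0) :
    (volume : Measure V) = ENNReal.ofReal |inner ℝ n v| •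
      ((planeMeasure n p).prod (volume : Measure ℝ)).map (fun q => q.1 + q.2 • v) := by
  have := sigmaFinite_planeMeasure hn p
  ext s hs
  rw [← lintegral_indicator_one hs, lintegral_eq_lintegral_plane hn p hv
    (measurable_one.indicator hs), Measure.smul_apply, Measure.map_apply (by fun_prop) hs,
    ← lintegral_indicator_one (hs.preimage (by fun_prop)), lintegral_prod _ (by
      exact (measurable_one.indicator (hs.preimage (by fun_prop))).aemeasurable)]
  rfl

theorem integral_eq_integral_plane {n : V} (hn : ‖n‖ = 1) (p : V) {v : V}
    (hv : inner ℝ n v ≠ 0) {f : V → ℝ} (hf : Integrable f) :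
    ∫ x, f x = |inner ℝ n v| * ∫ y, ∫ t : ℝ, f (y + t • v) ∂volume ∂(planeMeasure n p) := by
  have := sigmaFinite_planeMeasure hn p
  have hne : ENNReal.ofReal |inner ℝ n v| ≠ 0 := by simpa using hv
  have h := volume_eq_map_planeMeasure hn p hv
  rw [h] at hf
  have hf' := (integrable_smul_measure hne ENNReal.ofReal_ne_top).1 hf
  rw [h, integral_smul_measure, integral_map (by fun_prop) hf'.aestronglyMeasurable,
    integral_prod (fun q : V × ℝ => f (q.1 + q.2 • v)) (hf'.comp_measurable (by fun_prop)), ENNReal.toReal_ofReal (abs_nonneg _),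
    smul_eq_mul]

end Plane

/-! ### The divergence theorem on a simplex -/

section Simplex

variable {V : Type*} [NormedAddCommGroup V] [InnerProductSpace ℝ V] [FiniteDimensional ℝ V]
  {ι : Type*} (b : AffineBasis ι ℝ V)

/-- The closed simplex spanned by an affine basis, in barycentric coordinates. -/
def simplex : Set V := {x | ∀ j, 0 ≤ b.coord j x}

/-- The face of the simplex opposite to the vertex `b i`. -/
def face (i : ι) : Set V := {x | b.coord i x = 0 ∧ ∀ j, 0 ≤ b.coord j x}

/-- `n` is the outer unit normal on the face opposite to `b i`. -/
def IsFaceNormal (i : ι) (n : V) : Prop :=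
  ‖n‖ = 1 ∧ ∃ c > 0, ∀ x y, inner ℝ n (x - y) = -c * (b.coord i x - b.coord i y)

theorem continuous_coord (i : ι) : Continuous (b.coord i) :=
  (b.coord i).continuous_of_finiteDimensional

theorem coord_add (l : ι) (x w : V) : b.coord l (x + w) = (b.coord l).linear w + b.coord l x := by
  simpa [add_comm] using (b.coord l).map_vadd x w

/-- For i ≠ j, moving along an edge changes only the coordinates i and j, at rates -1 and 1. All
slicing below uses this. -/
theorem coord_add_edge (l i j : ι) (x : V) (t : ℝ) :
    b.coord l (x + t • (b j - b i)) =
      b.coord l x + t * (b.coord l (b j) - b.coord l (b i)) := by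
  have := (b.coord l).linearMap_vsub (b j) (b i)
  simp only [vsub_eq_sub] at this
  rw [coord_add, map_smul, this, smul_eq_mul, add_comm]

theorem simplex_eq_convexHull : simplex b = convexHull ℝ (Set.range b) :=
  b.convexHull_eq_nonneg_coord.symm

theorem isClosed_simplex : IsClosed (simplex b) := by
  simp only [simplex, Set.ofPred_forall]
  exact isClosed_iInter fun i => isClosed_le continuous_const (continuous_coord b i)

theorem isClosed_face (i : ι) : IsClosed (face b i) :=
  (isClosed_eq (continuous_coord b i) continuous_const).inter (isClosed_simplex b)

theorem face_subset_simplex (i : ι) : face b i ⊆ simplex b := fun _ h => h.2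

theorem isCompact_simplex [Finite ι] : IsCompact (simplex b) := by
  rw [simplex_eq_convexHull]
  exact (Set.finite_range b).isCompact_convexHull ℝ

theorem isCompact_face [Finite ι] (i : ι) : IsCompact (face b i) :=
  (isCompact_simplex b).of_isClosed_subset (isClosed_face b i) (face_subset_simplex b i)

variable [MeasurableSpace V] [BorelSpace V]

/-- The surface measure on a face. -/
def faceMeasure (i : ι) : Measure V :=
  (Measure.euclideanHausdorffMeasure (Module.finrank ℝ V - 1)).restrict (face b i)

variable {b}

theorem IsFaceNormal.plane_eq {i : ι} {n : V} (hn : IsFaceNormal b i n) {p : V}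
    (hp : b.coord i p = 0) : {x | inner ℝ n (x - p) = 0} = {x | b.coord i x = 0} := by
  obtain ⟨-, c, hc, h⟩ := hn
  ext x
  simp [h, hp, hc.ne']

theorem IsFaceNormal.faceMeasure_eq {i : ι} {n : V} (hn : IsFaceNormal b i n) {p : V}
    (hp : b.coord i p = 0) : faceMeasure b i = (planeMeasure n p).restrict (face b i) := by
  rw [faceMeasure, planeMeasure, hn.plane_eq hp, Measure.restrict_restrict
    (isClosed_face b i).measurableSet, Set.inter_eq_left.2 fun x hx => hx.1]

theorem IsFaceNormal.ae_plane {i : ι} {n : V} (hn : IsFaceNormal b i n) {p : V}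
    (hp : b.coord i p = 0) : ∀ᵐ x ∂(planeMeasure n p), b.coord i x = 0 := by
  rw [planeMeasure, hn.plane_eq hp]
  exact ae_restrict_mem (isClosed_eq (continuous_coord b i) continuous_const).measurableSet

theorem IsFaceNormal.isFiniteMeasure [Finite ι] {i j : ι} (hij : i ≠ j) {n : V}
    (hn : IsFaceNormal b i n) : IsFiniteMeasure (faceMeasure b i) := by
  rw [hn.faceMeasure_eq (b.coord_apply_ne hij)]
  exact ⟨by simpa using planeMeasure_isCompact_lt_top hn.1 (b j) (isCompact_face b i)⟩

theorem IsFaceNormal.integrable [Finite ι] {i j : ι} (hij : i ≠ j) {n : V}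
    (hn : IsFaceNormal b i n) {g : V → ℝ} (hg : Continuous g) :
    Integrable g (faceMeasure b i) := by
  have := hn.isFiniteMeasure hij
  have h : IntegrableOn g (face b i) (faceMeasure b i) :=
    hg.continuousOn.integrableOn_compact (isCompact_face b i)
  rwa [IntegrableOn, faceMeasure, Measure.restrict_restrict (isClosed_face b i).measurableSet,
    Set.inter_self] at h

/-- Projection onto a face along an edge. -/
theorem map_planeMeasure_edge {i j : ι} (hij : i ≠ j) {ni nj : V} (hi : IsFaceNormal b i ni)
    (hj : IsFaceNormal b j nj) (hvi : inner ℝ ni (b j - b i) ≠ 0)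
    (hvj : inner ℝ nj (b j - b i) ≠ 0) :
    ENNReal.ofReal |inner ℝ nj (b j - b i)| •
        (planeMeasure nj (b i)).map (fun y => y + b.coord i y • (b j - b i)) =
      ENNReal.ofReal |inner ℝ ni (b j - b i)| • planeMeasure ni (b j) := by
  have mi := (continuous_coord b i).measurable
  have mj := (continuous_coord b j).measurable
  ext B hB
  set v := b j - b i with hv
  have hP : Measurable fun y : V => y + b.coord i y • v := by fun_prop
  -- The volume of the slab T is computed by slicing from either hyperplane. The projection is
  -- constant on lines parallel to v, and coordinate j grows at unit rate along them, so each line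
  -- over B meets T in length 1.
  have hT : MeasurableSet ((fun y : V => y + b.coord i y • v) ⁻¹' B ∩
      (b.coord j) ⁻¹' Set.Ico 0 1) := (hP hB).inter (mj measurableSet_Ico)
  set T := (fun y : V => y + b.coord i y • v) ⁻¹' B ∩ (b.coord j) ⁻¹' Set.Ico 0 1 with hTd
  have hproj : ∀ (y : V) (t : ℝ), y + t • v + b.coord i (y + t • v) • v = y + b.coord i y • v := by
    intro y t
    rw [hv, coord_add_edge, b.coord_apply_eq, b.coord_apply_ne hij, ← hv, add_assoc, ← add_smul]
    congr 2
    ring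
  have hcj : ∀ (y : V) (t : ℝ), b.coord j (y + t • v) = b.coord j y + t := by
    intro y t
    rw [hv, coord_add_edge, b.coord_apply_eq, b.coord_apply_ne hij.symm]
    ring
  have hvol : ∀ (c : ℝ), ∫⁻ t : ℝ, (Set.Ico (0 : ℝ) 1).indicator 1 (c + t) = (1 : ENNReal) := by
    intro c
    rw [lintegral_add_left_eq_self (fun t : ℝ => (Set.Ico (0 : ℝ) 1).indicator 1 t) c,
      lintegral_indicator_one measurableSet_Ico]
    simp
  have hind : ∀ (y : V) (t : ℝ), T.indicator (1 : V → ENNReal) (y + t • v) =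
      B.indicator 1 (y + b.coord i y • v) * (Set.Ico (0 : ℝ) 1).indicator 1 (b.coord j y + t) := by
    intro y t
    have : y + t • v ∈ T ↔ y + b.coord i y • v ∈ B ∧ b.coord j y + t ∈ Set.Ico (0 : ℝ) 1 := by
      rw [hTd, Set.mem_inter_iff, Set.mem_preimage, Set.mem_preimage, hproj, hcj]
    by_cases h1 : y + b.coord i y • v ∈ B <;>
      by_cases h2 : b.coord j y + t ∈ Set.Ico (0 : ℝ) 1 <;> simp [Set.indicator, this, h1, h2]
  have key : ∀ (n p : V), ‖n‖ = 1 → inner ℝ n v ≠ 0 → volume T =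
      ENNReal.ofReal |inner ℝ n v| *
        ∫⁻ y, B.indicator 1 (y + b.coord i y • v) ∂(planeMeasure n p) := by
    intro n p hn hnv
    rw [← lintegral_indicator_one hT,
      lintegral_eq_lintegral_plane hn p hnv (measurable_one.indicator hT)]
    congr 1
    refine lintegral_congr fun y => ?_
    simp_rw [hind]
    rw [lintegral_const_mul _ (by
      exact (measurable_one.indicator measurableSet_Ico).comp (measurable_const_add _)), hvol,
      mul_one]
  rw [Measure.smul_apply, Measure.smul_apply, smul_eq_mul, smul_eq_mul]
  have e1 := key nj (b i) hj.1 hvj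
  rw [key ni (b j) hi.1 hvi] at e1
  have e2 : ∫⁻ y, B.indicator 1 (y + b.coord i y • v) ∂(planeMeasure nj (b i)) =
      (planeMeasure nj (b i)).map (fun y => y + b.coord i y • v) B := by
    rw [← lintegral_indicator_one hB, lintegral_map (measurable_one.indicator hB) hP]
  -- On the hyperplane of face i the projection is the identity.
  have e3 : ∫⁻ y, B.indicator 1 (y + b.coord i y • v) ∂(planeMeasure ni (b j)) =
      planeMeasure ni (b j) B := by
    rw [← lintegral_indicator_one hB]
    refine lintegral_congr_ae ?_
    filter_upwards [hi.ae_plane (b.coord_apply_ne hij)] with y hy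
    simp [hy]
  rw [← e2, ← e1, e3]

/-- On the hyperplane of face j the projection just exchanges the coordinates i and j. -/
theorem mem_face_edge {i j : ι} (hij : i ≠ j) {y : V} (hy : b.coord j y = 0) :
    y + b.coord i y • (b j - b i) ∈ face b i ↔ y ∈ face b j := by
  have hl : ∀ l, l ≠ i → l ≠ j →
      b.coord l (y + b.coord i y • (b j - b i)) = b.coord l y := by
    intro l h1 h2
    rw [coord_add_edge, b.coord_apply_ne h1, b.coord_apply_ne h2]; ring
  have h1 : b.coord i (y + b.coord i y • (b j - b i)) = 0 := by
    rw [coord_add_edge, b.coord_apply_eq, b.coord_apply_ne hij]; ring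
  have h2 : b.coord j (y + b.coord i y • (b j - b i)) = b.coord i y := by
    rw [coord_add_edge, b.coord_apply_eq, b.coord_apply_ne hij.symm, hy]; ring
  simp only [face, Set.mem_ofPred_eq, h1, hy, true_and]
  constructor
  · intro h l
    by_cases li : l = i
    · rw [li, ← h2]; exact h j
    by_cases lj : l = j
    · rw [lj, hy]
    rw [← hl l li lj]; exact h l
  · intro h l
    by_cases li : l = i
    · rw [li, h1]
    by_cases lj : l = j
    · rw [lj, h2]; exact h i
    rw [hl l li lj]; exact h l

theorem integral_face_edge {i j : ι} (hij : i ≠ j) {ni nj : V} (hi : IsFaceNormal b i ni)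
    (hj : IsFaceNormal b j nj) (hvi : inner ℝ ni (b j - b i) ≠ 0)
    (hvj : inner ℝ nj (b j - b i) ≠ 0) {g : V → ℝ} (hg : Continuous g) :
    |inner ℝ nj (b j - b i)| * ∫ y, g (y + b.coord i y • (b j - b i)) ∂(faceMeasure b j) =
      |inner ℝ ni (b j - b i)| * ∫ y, g y ∂(faceMeasure b i) := by
  have mi := (continuous_coord b i)
  have hP : Measurable fun y : V => y + b.coord i y • (b j - b i) :=
    (by fun_prop : Continuous fun y : V => y + b.coord i y • (b j - b i)).measurable
  have hm := map_planeMeasure_edge hij hi hj hvi hvj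
  have hF := (isClosed_face b i).measurableSet
  have h := congrArg (fun μ => ∫ y, (face b i).indicator g y ∂μ) hm
  simp only [integral_smul_measure, ENNReal.toReal_ofReal (abs_nonneg _), smul_eq_mul] at h
  rw [integral_map hP.aemeasurable (hg.stronglyMeasurable.indicator hF).aestronglyMeasurable,
    integral_indicator hF, ← hi.faceMeasure_eq (b.coord_apply_ne hij)] at h
  rw [← h, hj.faceMeasure_eq (b.coord_apply_ne hij.symm),
    ← integral_indicator (isClosed_face b j).measurableSet]
  congr 1
  refine integral_congr_ae ?_
  filter_upwards [hj.ae_plane (b.coord_apply_ne hij.symm)] with y hy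
  by_cases hyf : y ∈ face b j
  · rw [Set.indicator_of_mem hyf, Set.indicator_of_mem ((mem_face_edge hij hy).2 hyf)]
  · rw [Set.indicator_of_notMem hyf,
      Set.indicator_of_notMem (fun h' => hyf ((mem_face_edge hij hy).1 h'))]

/-- The chord starting at y has coordinate j equal to t and coordinate i equal to its initial value
minus t, so it leaves the simplex through face i when the latter reaches 0. -/
theorem mem_simplex_edge {i j : ι} (hij : i ≠ j) {y : V} (hy : b.coord j y = 0) (t : ℝ) :
    y + t • (b j - b i) ∈ simplex b ↔ y ∈ face b j ∧ t ∈ Set.Icc 0 (b.coord i y) := by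
  have hl : ∀ l, l ≠ i → l ≠ j → b.coord l (y + t • (b j - b i)) = b.coord l y := by
    intro l h1 h2
    rw [coord_add_edge, b.coord_apply_ne h1, b.coord_apply_ne h2]; ring
  have h1 : b.coord i (y + t • (b j - b i)) = b.coord i y - t := by
    rw [coord_add_edge, b.coord_apply_eq, b.coord_apply_ne hij]; ring
  have h2 : b.coord j (y + t • (b j - b i)) = t := by
    rw [coord_add_edge, b.coord_apply_eq, b.coord_apply_ne hij.symm, hy]; ring
  simp only [face, simplex, Set.mem_ofPred_eq, hy, true_and, Set.mem_Icc]
  constructor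
  · intro h
    have hi := h i
    have hj := h j
    rw [h1] at hi
    rw [h2] at hj
    refine ⟨fun l => ?_, hj, by linarith⟩
    by_cases li : l = i
    · rw [li]; linarith
    by_cases lj : l = j
    · rw [lj, hy]
    rw [← hl l li lj]; exact h l
  · rintro ⟨h, h0, h3⟩ l
    by_cases li : l = i
    · rw [li, h1]; linarith
    by_cases lj : l = j
    · rw [lj, h2]; exact h0
    rw [hl l li lj]; exact h l

/-- Slice into chords from face j to face i. The fundamental theorem of calculus leaves the
difference of g at the two ends, and `integral_face_edge` moves the exit value to face i. The edge
points outward at face i and inward at face j, which gives the signs. -/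
theorem integral_simplex_edge [Finite ι] {i j : ι} (hij : i ≠ j) {ni nj : V}
    (hi : IsFaceNormal b i ni) (hj : IsFaceNormal b j nj) {g : V → ℝ} (hg : ContDiff ℝ 1 g) :
    ∫ x in simplex b, fderiv ℝ g x (b j - b i) =
      inner ℝ ni (b j - b i) * ∫ y, g y ∂(faceMeasure b i) +
        inner ℝ nj (b j - b i) * ∫ y, g y ∂(faceMeasure b j) := by
  have hvi : 0 < inner ℝ ni (b j - b i) := by
    obtain ⟨-, c, hc, h⟩ := hi
    rw [h, b.coord_apply_eq, b.coord_apply_ne hij]; simpa using hc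
  have hvj : inner ℝ nj (b j - b i) < 0 := by
    obtain ⟨-, c, hc, h⟩ := hj
    rw [h, b.coord_apply_eq, b.coord_apply_ne hij.symm]; simpa using hc
  have hc : Continuous fun x => fderiv ℝ g x (b j - b i) := by
    have := hg.continuous_fderiv one_ne_zero
    fun_prop
  have hS := (isClosed_simplex b).measurableSet
  have hint : Integrable ((simplex b).indicator fun x => fderiv ℝ g x (b j - b i)) :=
    (integrable_indicator_iff hS).2 (hc.continuousOn.integrableOn_compact (isCompact_simplex b))
  have hbi := b.coord_apply_ne hij.symm
  rw [← integral_indicator hS, integral_eq_integral_plane hj.1 (b i) hvj.ne hint]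
  have hline : ∫ y, ∫ t : ℝ, (simplex b).indicator (fun x => fderiv ℝ g x (b j - b i))
      (y + t • (b j - b i)) ∂volume ∂(planeMeasure nj (b i)) =
      ∫ y, (g (y + b.coord i y • (b j - b i)) - g y) ∂(faceMeasure b j) := by
    rw [hj.faceMeasure_eq hbi, ← integral_indicator (isClosed_face b j).measurableSet]
    refine integral_congr_ae ?_
    filter_upwards [hj.ae_plane hbi] with y hy
    by_cases hyf : y ∈ face b j
    · rw [Set.indicator_of_mem hyf]
      have : (fun t : ℝ => (simplex b).indicator (fun x => fderiv ℝ g x (b j - b i))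
          (y + t • (b j - b i))) = (Set.Icc 0 (b.coord i y)).indicator
            fun t => fderiv ℝ g (y + t • (b j - b i)) (b j - b i) := by
        ext t
        by_cases ht : t ∈ Set.Icc 0 (b.coord i y)
        · rw [Set.indicator_of_mem ht,
            Set.indicator_of_mem ((mem_simplex_edge hij hy t).2 ⟨hyf, ht⟩)]
        · rw [Set.indicator_of_notMem ht,
            Set.indicator_of_notMem (fun h => ht ((mem_simplex_edge hij hy t).1 h).2)]
      rw [this, integral_indicator measurableSet_Icc, integral_Icc_eq_integral_Ioc,
        ← intervalIntegral.integral_of_le (hyf.2 i),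
        intervalIntegral.integral_eq_sub_of_hasDerivAt
          (f := fun t : ℝ => g (y + t • (b j - b i)))]
      · simp
      · intro t _
        have h1 : HasDerivAt (fun t : ℝ => y + t • (b j - b i)) (b j - b i) t := by
          simpa using ((hasDerivAt_id t).smul_const (b j - b i)).const_add y
        exact ((hg.differentiable one_ne_zero _).hasFDerivAt).comp_hasDerivAt t h1
      · refine Continuous.intervalIntegrable ?_ _ _
        exact hc.comp (by fun_prop)
    · rw [Set.indicator_of_notMem hyf]
      have : (fun t : ℝ => (simplex b).indicator (fun x => fderiv ℝ g x (b j - b i))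
          (y + t • (b j - b i))) = fun _ => 0 := by
        ext t
        rw [Set.indicator_of_notMem (fun h => hyf ((mem_simplex_edge hij hy t).1 h).1)]
      rw [this]
      simp
  have mi := continuous_coord b i
  have hgc := hg.continuous
  rw [hline, integral_sub (hj.integrable hij.symm (by fun_prop)) (hj.integrable hij.symm hgc),
    mul_sub, integral_face_edge hij hi hj hvi.ne' hvj.ne hgc, abs_of_pos hvi, abs_of_neg hvj]
  ring

/-- By linearity, it therefore suffices to prove the divergence theorem in edge directions. -/
theorem span_edges_eq_top : Submodule.span ℝ {v | ∃ i j, i ≠ j ∧ v = b j - b i} = ⊤ := by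
  have h1 : vectorSpan ℝ (Set.range b) = ⊤ := by
    rw [← direction_affineSpan, b.tot, AffineSubspace.direction_top]
  rw [eq_top_iff, ← h1, vectorSpan_def, Submodule.span_le]
  rintro _ ⟨_, ⟨j, rfl⟩, _, ⟨i, rfl⟩, rfl⟩
  by_cases h : i = j
  · subst h; simp
  · exact Submodule.subset_span ⟨i, j, h, rfl⟩

/-- The divergence theorem on a simplex. -/
theorem integral_simplex_fderiv [Fintype ι] [Nontrivial ι] {n : ι → V}
    (hn : ∀ i, IsFaceNormal b i (n i)) {g : V → ℝ} (hg : ContDiff ℝ 1 g) (v : V) :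
    ∫ x in simplex b, fderiv ℝ g x v =
      ∑ i, inner ℝ (n i) v * ∫ y, g y ∂(faceMeasure b i) := by
  have hc : ∀ v, IntegrableOn (fun x => fderiv ℝ g x v) (simplex b) := fun v => by
    have := hg.continuous_fderiv one_ne_zero
    exact (by fun_prop : Continuous fun x => fderiv ℝ g x v).continuousOn.integrableOn_compact
      (isCompact_simplex b)
  have hv : v ∈ Submodule.span ℝ {v | ∃ i j, i ≠ j ∧ v = b j - b i} := by
    rw [span_edges_eq_top]; trivial
  induction hv using Submodule.span_induction with
  | mem v h =>
    classical
    obtain ⟨i, j, hij, rfl⟩ := h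
    rw [integral_simplex_edge hij (hn i) (hn j) hg, ← Finset.add_sum_erase _ _ (Finset.mem_univ i),
      ← Finset.add_sum_erase _ _ (Finset.mem_erase.2 ⟨hij.symm, Finset.mem_univ j⟩),
      Finset.sum_eq_zero, add_zero]
    -- Every remaining face contains both ends of the edge, so its normal is orthogonal to the edge.
    intro l hl
    simp only [Finset.mem_erase, Finset.mem_univ, and_true] at hl
    obtain ⟨-, c, hc, h⟩ := hn l
    rw [h, b.coord_apply_ne hl.1, b.coord_apply_ne hl.2]
    simp
  | zero => simp
  | add x y _ _ hx hy =>
    simp only [map_add, inner_add_right, add_mul, Finset.sum_add_distrib]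
    rw [integral_add (hc x) (hc y), hx, hy]
  | smul a x _ hx =>
    simp only [map_smul, inner_smul_right, smul_eq_mul, mul_assoc]
    rw [integral_const_mul, hx, Finset.mul_sum]

/-- The hyperplane E has volume zero and is invariant along b m - b i, which is transversal to face
i. Slicing in that direction shows that zero is a nonzero multiple of the plane measure of E times
the infinite length of a line. -/
theorem IsFaceNormal.faceMeasure_coord_eq_zero {i l m : ι} (hil : i ≠ l) (him : i ≠ m)
    (hlm : l ≠ m) {n : V} (hn : IsFaceNormal b i n) :
    faceMeasure b i {x | b.coord l x = 0} = 0 := by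
  set E : Set V := {x | b.coord l x = 0} with hE
  have hEm : MeasurableSet E :=
    (isClosed_eq (continuous_coord b l) continuous_const).measurableSet
  have hv : inner ℝ n (b m - b i) ≠ 0 := by
    obtain ⟨-, c, hc, h⟩ := hn
    rw [h, b.coord_apply_eq, b.coord_apply_ne him]; simpa using hc.ne'
  have hvol : volume E = 0 := by
    have : E = ((AffineSubspace.mk' (0 : ℝ) ⊥).comap (b.coord l) : Set V) := by
      ext x
      simp [hE, AffineSubspace.mem_mk']
    rw [this]
    refine Measure.addHaar_affineSubspace _ _ fun htop => ?_
    have hm : b l ∈ (AffineSubspace.mk' (0 : ℝ) ⊥).comap (b.coord l) := by rw [htop]; trivial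
    simp [AffineSubspace.mem_comap, AffineSubspace.mem_mk'] at hm
  have hind : ∀ (y : V) (t : ℝ), E.indicator (1 : V → ENNReal) (y + t • (b m - b i)) =
      E.indicator 1 y := by
    intro y t
    have : y + t • (b m - b i) ∈ E ↔ y ∈ E := by
      simp only [hE, Set.mem_ofPred_eq]
      rw [coord_add_edge, b.coord_apply_ne hlm, b.coord_apply_ne hil.symm]
      simp
    by_cases h : y ∈ E <;> simp [Set.indicator, this, h]
  rw [← lintegral_indicator_one hEm, lintegral_eq_lintegral_plane hn.1 (b l) hv
    (measurable_one.indicator hEm)] at hvol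
  simp_rw [hind] at hvol
  simp only [lintegral_const, Real.volume_univ] at hvol
  rw [lintegral_mul_const _ (measurable_one.indicator hEm), lintegral_indicator_one hEm] at hvol
  have h0 : planeMeasure n (b l) E = 0 := by
    simpa [hv] using hvol
  rw [hn.faceMeasure_eq (b.coord_apply_ne hil)]
  exact Measure.restrict_le_self.absolutelyContinuous h0

end Simplex

/-! ### Polynomial fields: derivatives and integration by parts -/

section Polynomials

variable {d : ℕ}

theorem ev_add (p q : Poly d) (x : Eu d) : ev (p + q) x = ev p x + ev q x := by simp [ev]

theorem ev_sub (p q : Poly d) (x : Eu d) : ev (p - q) x = ev p x - ev q x := by simp [ev]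

theorem ev_mul (p q : Poly d) (x : Eu d) : ev (p * q) x = ev p x * ev q x := by simp [ev]

theorem ev_sum {α : Type*} (s : Finset α) (p : α → Poly d) (x : Eu d) :
    ev (∑ i ∈ s, p i) x = ∑ i ∈ s, ev (p i) x := by simp [ev]

theorem hasFDerivAt_ev (p : Poly d) (x : Eu d) :
    HasFDerivAt (ev p) (∑ i, ev (MvPolynomial.pderiv i p) x •
      (EuclideanSpace.proj i : Eu d →L[ℝ] ℝ)) x := by
  classical
  induction p using MvPolynomial.induction_on with
  | C a =>
    refine ((hasFDerivAt_const a x).congr_fderiv ?_).congr_of_eventuallyEq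
      (.of_forall fun y => by simp [ev])
    simp [ev]
  | add p q hp hq =>
    have := hp.add hq
    refine (this.congr_fderiv ?_).congr_of_eventuallyEq (.of_forall fun y => ev_add p q y)
    simp [ev_add, add_smul, Finset.sum_add_distrib]
  | mul_X p j hp =>
    have hX : HasFDerivAt (fun y : Eu d => y j) (EuclideanSpace.proj j : Eu d →L[ℝ] ℝ) x :=
      (EuclideanSpace.proj j : Eu d →L[ℝ] ℝ).hasFDerivAt
    have := hp.mul hX
    refine (this.congr_fderiv ?_).congr_of_eventuallyEq
      (.of_forall fun y => by simp [ev])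
    ext v
    simp only [ev, Derivation.leibniz, MvPolynomial.pderiv_X, smul_eq_mul, map_add, map_mul,
      MvPolynomial.eval_X, add_smul, Finset.sum_add_distrib, add_apply,
      sum_apply, smul_apply, PiLp.proj_apply]
    congr 1
    · rw [Finset.sum_eq_single j] <;> simp +contextual
    · rw [Finset.mul_sum]
      exact Finset.sum_congr rfl fun i _ => by ring

theorem contDiff_ev (p : Poly d) : ContDiff ℝ ∞ (ev p) := by
  induction p using MvPolynomial.induction_on with
  | C a =>
    have h : ev (MvPolynomial.C a : Poly d) = fun _ => a := funext fun x => by simp [ev]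
    rw [h]
    exact contDiff_const
  | add p q hp hq =>
    have h : ev (p + q) = fun x => ev p x + ev q x := funext fun x => ev_add p q x
    rw [h]
    exact hp.add hq
  | mul_X p j hp =>
    have h : ev (p * MvPolynomial.X j) = fun x => ev p x * x j := funext fun x => by simp [ev]
    rw [h]
    exact hp.mul (EuclideanSpace.proj j : Eu d →L[ℝ] ℝ).contDiff

theorem continuous_ev (p : Poly d) : Continuous (ev p) := (contDiff_ev p).continuous

theorem continuous_evVec (τ : PolyVec d) : Continuous (evVec τ) :=
  (PiLp.continuous_toLp 2 _).comp (continuous_pi fun i => continuous_ev (τ i))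

theorem fderiv_ev (p : Poly d) (x v : Eu d) :
    fderiv ℝ (ev p) x v = inner ℝ v (evVec (grad p) x) := by
  rw [(hasFDerivAt_ev p x).fderiv]
  simp [evVec, grad, PiLp.inner_apply]

/-- The divergence of a polynomial vector field. -/
def polyDiv (τ : PolyVec d) : Poly d := ∑ i, MvPolynomial.pderiv i (τ i)

theorem eq_sum_single (w : Eu d) : w = ∑ i, w i • EuclideanSpace.single i (1 : ℝ) := by
  ext j
  simp [Finset.sum_apply, Pi.single_apply]

/-- Integration by parts on a simplex. -/
theorem integral_simplex_by_parts {ι : Type*} [Fintype ι] [Nontrivial ι]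
    {b : AffineBasis ι ℝ (Eu d)} {n : ι → Eu d} (hn : ∀ i, IsFaceNormal b i (n i)) (τ : PolyVec d)
    {φ : Eu d → ℝ} (hφ : ContDiff ℝ 1 φ) :
    ∫ x in simplex b, (fderiv ℝ φ x (evVec τ x) + φ x * ev (polyDiv τ) x) =
      ∑ i, ∫ y, φ y * inner ℝ (evVec τ y) (n i) ∂(faceMeasure b i) := by
  have hτ : ∀ j, ContDiff ℝ 1 (ev (τ j)) := fun j => (contDiff_ev (τ j)).of_le (by simp)
  have hg : ∀ j, ContDiff ℝ 1 fun x => φ x * ev (τ j) x := fun j => hφ.mul (hτ j)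
  -- By the product rule the integrand is div(φ τ), so the divergence theorem applies to each φ τ_j
  -- in direction e_j.
  have hpt : ∀ x, fderiv ℝ φ x (evVec τ x) + φ x * ev (polyDiv τ) x =
      ∑ j, fderiv ℝ (fun x => φ x * ev (τ j) x) x (EuclideanSpace.single j 1) := by
    intro x
    conv_lhs => rw [eq_sum_single (evVec τ x), map_sum, polyDiv, ev_sum, Finset.mul_sum,
      ← Finset.sum_add_distrib]
    refine Finset.sum_congr rfl fun j _ => ?_
    have h := (hφ.differentiable one_ne_zero x).hasFDerivAt.mul (hasFDerivAt_ev (τ j) x)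
    change HasFDerivAt (fun x => φ x * ev (τ j) x) _ x at h
    rw [h.fderiv]
    simp [evVec]
    ring
  simp_rw [hpt]
  rw [integral_finsetSum]
  · simp_rw [integral_simplex_fderiv hn (hg _)]
    rw [Finset.sum_comm]
    refine Finset.sum_congr rfl fun i _ => ?_
    obtain ⟨j, hj⟩ := exists_ne i
    have : ∀ y, φ y * inner ℝ (evVec τ y) (n i) =
        ∑ l, inner ℝ (n i) (EuclideanSpace.single l (1 : ℝ)) * (φ y * ev (τ l) y) := by
      intro y
      rw [PiLp.inner_apply, Finset.mul_sum]
      refine Finset.sum_congr rfl fun l _ => ?_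
      simp [evVec, EuclideanSpace.inner_single_right]
      ring
    simp_rw [this]
    rw [integral_finsetSum]
    · simp_rw [integral_const_mul]
    · intro l _
      exact ((hn i).integrable hj.symm (hg l).continuous).const_mul _
  · intro j _
    have h := (hg j).continuous_fderiv one_ne_zero
    exact (by fun_prop : Continuous fun x => fderiv ℝ (fun x => φ x * ev (τ j) x) x
      (EuclideanSpace.single j 1)).continuousOn.integrableOn_compact (isCompact_simplex b)

end Polynomials

/-! ### Faces and normals in barycentric coordinates -/

section AffineBasisNormals

variable {V : Type*} [NormedAddCommGroup V] [InnerProductSpace ℝ V] [FiniteDimensional ℝ V]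
  {ι : Type*} [Fintype ι] {b : AffineBasis ι ℝ V}

theorem convex_simplex : Convex ℝ (simplex b) := by
  rw [simplex_eq_convexHull]
  exact convex_convexHull ℝ _

theorem convex_face (i : ι) : Convex ℝ (face b i) := by
  have h : Convex ℝ ((b.coord i) ⁻¹' {0}) := (convex_singleton (0 : ℝ)).affine_preimage (b.coord i)
  exact h.inter convex_simplex

theorem convexHull_eq_face (i : ι) : convexHull ℝ (b '' {i}ᶜ) = face b i := by
  classical
  apply Set.Subset.antisymm
  · refine convexHull_min ?_ (convex_face i)
    rintro _ ⟨j, hj, rfl⟩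
    refine ⟨b.coord_apply_ne fun h => hj h.symm, fun l => ?_⟩
    rw [b.coord_apply]
    split_ifs <;> simp
  · intro x hx
    have h1 := b.linear_combination_coord_eq_self x
    have h2 := b.sum_coord_apply_eq_one x
    rw [← Finset.add_sum_erase _ _ (Finset.mem_univ i), hx.1] at h1 h2
    rw [zero_smul, zero_add] at h1
    rw [zero_add] at h2
    rw [← h1]
    refine (convex_convexHull ℝ _).sum_mem (fun j _ => hx.2 j) h2 fun j hj => ?_
    exact subset_convexHull ℝ _ ⟨j, by simpa using hj, rfl⟩

/-- Expand x - y in the vectors b j - b k; the base point cancels because coordinates sum to 1. Only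
the term j = i is not orthogonal to n by hypothesis. -/
theorem inner_eq_coord {i : ι} {n : V} (hn : ∀ j k, j ≠ i → k ≠ i → inner ℝ n (b j - b k) = 0)
    {k : ι} (hk : k ≠ i) (x y : V) :
    inner ℝ n (x - y) = inner ℝ n (b i - b k) * (b.coord i x - b.coord i y) := by
  classical
  have h : x - y = ∑ j, (b.coord j x - b.coord j y) • (b j - b k) := by
    simp only [smul_sub, sub_smul, Finset.sum_sub_distrib, ← Finset.sum_smul,
      b.sum_coord_apply_eq_one, b.linear_combination_coord_eq_self]
    abel
  rw [h, inner_sum, Finset.sum_eq_single i, inner_smul_right, mul_comm]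
  · intro j _ hj
    rw [inner_smul_right, hn j k hj hk, mul_zero]
  · simp

/-- The normal is the normalized Riesz representative of the linear part of coordinate i, negated
since that coordinate grows inward. A second vertex makes it nonzero. -/
theorem exists_isFaceNormal [Nontrivial ι] (i : ι) : ∃ n, IsFaceNormal b i n := by
  let ℓ : V →L[ℝ] ℝ := (b.coord i).linear.toContinuousLinearMap
  let w := (InnerProductSpace.toDual ℝ V).symm ℓ
  have hw : ∀ x y, inner ℝ w (x - y) = b.coord i x - b.coord i y := by
    intro x y
    rw [InnerProductSpace.toDual_symm_apply]
    have := (b.coord i).linearMap_vsub x y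
    simpa [ℓ] using this
  have hw0 : w ≠ 0 := by
    intro h
    obtain ⟨j, hj⟩ := exists_ne i
    have := hw (b i) (b j)
    rw [h, b.coord_apply_eq, b.coord_apply_ne hj.symm] at this
    simp at this
  have hn : 0 < ‖w‖ := norm_pos_iff.2 hw0
  refine ⟨-(‖w‖⁻¹ • w), by rw [norm_neg, norm_smul]; simp [hn.ne'], ‖w‖⁻¹, by positivity, ?_⟩
  intro x y
  rw [inner_neg_left, real_inner_smul_left, hw]
  ring

end AffineBasisNormals

/-! ### Elements of the mesh and integrals over Ω -/

section MeshGeometry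

variable {d : ℕ} {Ω : Set (Eu d)} {M : Mesh d Ω}

/-- The vertices of an element as an affine basis. -/
def Mesh.basis (M : Mesh d Ω) (K : M.elems) : AffineBasis {x // x ∈ K.1} ℝ (Eu d) where
  toFun x := x
  ind' := M.indep K K.2
  tot' := by
    rw [(M.indep K K.2).affineSpan_eq_top_iff_card_eq_finrank_add_one]
    simp [M.card_eq K K.2]

@[simp]
theorem Mesh.basis_apply (K : M.elems) (i : {x // x ∈ K.1}) : M.basis K i = i := rfl

theorem Mesh.hull_eq_simplex (K : M.elems) : hull K.1 = simplex (M.basis K) := by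
  rw [simplex_eq_convexHull, hull]
  congr 1
  ext x
  simp

theorem Mesh.hull_erase [DecidableEq (Eu d)] (K : M.elems) (i : {x // x ∈ K.1}) :
    hull (K.1.erase i) = face (M.basis K) i := by
  rw [← convexHull_eq_face, hull]
  congr 1
  ext x
  simp only [Finset.coe_erase, Set.mem_sdiff, Finset.mem_coe, Set.mem_singleton_iff,
    Set.mem_image, Set.mem_compl_iff, Mesh.basis_apply]
  constructor
  · rintro ⟨h, h'⟩
    exact ⟨⟨x, h⟩, fun e => h' (by rw [← e]), rfl⟩
  · rintro ⟨y, h, rfl⟩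
    exact ⟨y.2, fun e => h (Subtype.ext e)⟩

theorem Mesh.facetMeasure_erase [DecidableEq (Eu d)] (K : M.elems) (i : {x // x ∈ K.1}) :
    facetMeasure (K.1.erase i) = faceMeasure (M.basis K) i := by
  rw [facetMeasure, faceMeasure, M.hull_erase, finrank_euclideanSpace_fin]

theorem Mesh.interior_hull (K : M.elems) :
    interior (hull K.1) = {x | ∀ i, 0 < (M.basis K).coord i x} := by
  rw [M.hull_eq_simplex, simplex_eq_convexHull, (M.basis K).interior_convexHull]

theorem Mesh.isCompact_hull (K : M.elems) : IsCompact (hull K.1) := by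
  rw [M.hull_eq_simplex]
  exact isCompact_simplex _

theorem Mesh.convex_hull (K : M.elems) : Convex ℝ (hull K.1) := convex_convexHull ℝ _

theorem Mesh.nontrivial (hd : 2 ≤ d) (K : M.elems) : Nontrivial {x // x ∈ K.1} := by
  rw [← Fintype.one_lt_card_iff_nontrivial, Fintype.card_coe, M.card_eq K K.2]
  omega

/-- By conformity the intersection is the hull of the common vertices, hence lies in the face of K
opposite to the missing vertex i. -/
theorem Mesh.coord_eq_zero_of_mem_inter {K L : M.elems} {i : {x // x ∈ K.1}} (hi : i.1 ∉ L.1)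
    {x : Eu d} (hK : x ∈ hull K.1) (hL : x ∈ hull L.1) : (M.basis K).coord i x = 0 := by
  classical
  have h : x ∈ hull (K.1.erase i) := by
    have h1 : x ∈ hull K.1 ∩ hull L.1 := ⟨hK, hL⟩
    rw [M.conforming K K.2 L L.2] at h1
    refine convexHull_mono ?_ h1
    rintro y ⟨h2, h3⟩
    rw [Finset.coe_erase]
    exact ⟨h2, fun e => hi (by rw [← (e : y = i.1)]; exact h3)⟩
  rw [M.hull_erase] at h
  exact h.1

theorem Mesh.exists_mem_notMem {K L : M.elems} (h : K ≠ L) : ∃ i ∈ K.1, i ∉ L.1 := by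
  by_contra hc
  push Not at hc
  exact h (Subtype.ext (Finset.eq_of_subset_of_card_le hc
    (by rw [M.card_eq K K.2, M.card_eq L L.2])))

/-- Some vertex of K is not in L. Its coordinate vanishes on the intersection but is positive inside
K. -/
theorem Mesh.disjoint_interior {K L : M.elems} (h : K ≠ L) :
    Disjoint (interior (hull K.1)) (hull L.1) := by
  obtain ⟨i, hi, hi'⟩ := M.exists_mem_notMem h
  rw [Set.disjoint_left]
  intro x hx hL
  have h1 := M.coord_eq_zero_of_mem_inter (i := ⟨i, hi⟩) hi' (interior_subset hx) hL
  rw [M.interior_hull] at hx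
  exact (hx ⟨i, hi⟩).ne' h1

theorem Mesh.isOpen (M : Mesh d Ω) : IsOpen Ω := by rw [M.fills]; exact isOpen_interior

theorem Mesh.interior_subset (K : M.elems) : interior (hull K.1) ⊆ Ω := by
  conv_rhs => rw [M.fills]
  exact interior_mono (Set.subset_biUnion_of_mem (u := fun K : Finset (Eu d) => hull K) K.2)

theorem Mesh.subset_iUnion (M : Mesh d Ω) : Ω ⊆ ⋃ K : M.elems, hull K.1 := by
  conv_lhs => rw [M.fills]
  refine _root_.interior_subset.trans ?_
  exact Set.iUnion₂_subset fun K hK => Set.subset_iUnion (fun K : M.elems => hull K.1) ⟨K, hK⟩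

theorem Mesh.interior_ae_eq (K : M.elems) : interior (hull K.1) =ᵐ[volume] hull K.1 := by
  refine (ae_eq_set.2 ⟨by simp [Set.sdiff_eq_empty.2 _root_.interior_subset], ?_⟩)
  have h := (M.convex_hull K).addHaar_frontier volume
  rwa [frontier, (M.isCompact_hull K).isClosed.closure_eq] at h

/-- Element boundaries are null by convexity, so the fact that `glue` ignores them is harmless. -/
theorem Mesh.ae_eq_iUnion (M : Mesh d Ω) :
    Ω =ᵐ[volume] ⋃ K : M.elems, interior (hull K.1) := by
  have h : (⋃ K : M.elems, interior (hull K.1)) =ᵐ[volume] ⋃ K : M.elems, hull K.1 :=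
    Filter.EventuallyEq.countable_iUnion fun K => M.interior_ae_eq K
  have h1 := ae_le_set.1 h.symm.le
  refine ae_eq_set.2 ⟨measure_mono_null (Set.sdiff_subset_sdiff_left M.subset_iUnion) h1, ?_⟩
  rw [Set.sdiff_eq_empty.2 (Set.iUnion_subset fun K => M.interior_subset K), measure_empty]

theorem glue_eq {β : Type*} [AddCommMonoid β] (v : M.elems → Eu d → β) {K : M.elems} {x : Eu d}
    (hx : x ∈ interior (hull K.1)) : glue M v x = v K x := by
  classical
  rw [glue, Finset.sum_eq_single K, Set.indicator_of_mem hx]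
  · intro L _ hL
    rw [Set.indicator_of_notMem]
    exact fun h => Set.disjoint_left.1 (M.disjoint_interior hL.symm) hx (_root_.interior_subset h)
  · simp

theorem Mesh.integrableOn_of_piecewise {h : Eu d → ℝ}
    (hi : ∀ K : M.elems, IntegrableOn h (hull K.1)) : IntegrableOn h Ω := by
  have h1 : IntegrableOn h (⋃ K : M.elems, hull K.1) :=
    (integrableOn_finite_iUnion).2 hi
  exact h1.mono_set M.subset_iUnion

theorem Mesh.setIntegral_eq_sum {h : Eu d → ℝ} (hi : ∀ K : M.elems, IntegrableOn h (hull K.1)) :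
    ∫ x in Ω, h x = ∑ K : M.elems, ∫ x in hull K.1, h x := by
  rw [setIntegral_congr_set M.ae_eq_iUnion, integral_iUnion_fintype
    (fun K => isOpen_interior.measurableSet)
    (fun K L hKL => (M.disjoint_interior hKL).mono_right _root_.interior_subset)
    (fun K => (hi K).mono_set _root_.interior_subset)]
  exact Finset.sum_congr rfl fun K _ => setIntegral_congr_set (M.interior_ae_eq K)

theorem Mesh.ae_hull_iff {K : M.elems} {p : Eu d → Prop} :
    (∀ᵐ x ∂(volume.restrict (hull K.1)), p x) ↔ ∀ᵐ x, x ∈ interior (hull K.1) → p x := by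
  rw [← Measure.restrict_congr_set (M.interior_ae_eq K),
    ae_restrict_iff' isOpen_interior.measurableSet]

/-- The integral over `Ω` of a function given on the elements up to null sets. -/
theorem Mesh.setIntegral_eq_sum_of_ae {h : Eu d → ℝ} {h' : M.elems → Eu d → ℝ}
    (hc : ∀ K, Continuous (h' K)) (he : ∀ K, ∀ᵐ x, x ∈ interior (hull K.1) → h x = h' K x) :
    IntegrableOn h Ω ∧ ∫ x in Ω, h x = ∑ K : M.elems, ∫ x in hull K.1, h' K x := by
  have h1 : ∀ K : M.elems, h =ᵐ[volume.restrict (hull K.1)] h' K := fun K => M.ae_hull_iff.2 (he K)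
  have h2 : ∀ K : M.elems, IntegrableOn h (hull K.1) := fun K =>
    ((hc K).continuousOn.integrableOn_compact (M.isCompact_hull K)).congr (h1 K).symm
  refine ⟨M.integrableOn_of_piecewise h2, ?_⟩
  rw [M.setIntegral_eq_sum h2]
  exact Finset.sum_congr rfl fun K _ => integral_congr_ae (h1 K)

end MeshGeometry

/-! ### The weak divergence is the piecewise divergence -/

section WeakDivergence

variable {d : ℕ} {Ω : Set (Eu d)} {M : Mesh d Ω}

theorem IsTest.mono {U W : Set (Eu d)} (h : U ⊆ W) {φ : Eu d → ℝ} (hφ : IsTest U φ) :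
    IsTest W φ := ⟨hφ.1, hφ.2.1, hφ.2.2.trans h⟩

theorem IsTest.eq_zero {U : Set (Eu d)} {φ : Eu d → ℝ} (hφ : IsTest U φ) {x : Eu d} (hx : x ∉ U) :
    φ x = 0 := image_eq_zero_of_notMem_tsupport fun h => hx (hφ.2.2 h)

theorem IsTest.fderiv_eq_zero {U : Set (Eu d)} {φ : Eu d → ℝ} (hφ : IsTest U φ) {x : Eu d}
    (hx : x ∉ U) : fderiv ℝ φ x = 0 :=
  fderiv_of_notMem_tsupport (𝕜 := ℝ) fun h => hx (hφ.2.2 h)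

theorem weakDiv_spec {τ : Eu d → Eu d} (h : MemHdiv Ω τ) : IsWeakDiv Ω τ (weakDiv Ω τ) := by
  rw [weakDiv, dif_pos h.2]
  exact h.2.choose_spec

theorem IsTest.continuous_fderiv_apply {U : Set (Eu d)} {φ : Eu d → ℝ} (hφ : IsTest U φ)
    (τ : PolyVec d) : Continuous fun x => fderiv ℝ φ x (evVec τ x) := by
  have h1 := hφ.1.continuous_fderiv (by simp)
  have h2 := continuous_evVec τ
  fun_prop

theorem integral_fderiv_fnVec {φ : Eu d → ℝ} {U : Set (Eu d)} (hφ : IsTest U φ)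
    (τ : M.elems → PolyVec d) :
    IntegrableOn (fun x => fderiv ℝ φ x (fnVec M τ x)) Ω ∧
    ∫ x in Ω, fderiv ℝ φ x (fnVec M τ x) =
      ∑ K : M.elems, ∫ x in hull K.1, fderiv ℝ φ x (evVec (τ K) x) := by
  refine M.setIntegral_eq_sum_of_ae (fun K => hφ.continuous_fderiv_apply (τ K))
    fun K => .of_forall fun x hx => ?_
  rw [fnVec, glue_eq _ hx]

/-- The distributional divergence of a piecewise polynomial field is its piecewise divergence. -/
theorem weakDiv_ae_eq (hd : 2 ≤ d) {τ : M.elems → PolyVec d} (hτ : MemHdiv Ω (fnVec M τ))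
    (K : M.elems) : ∀ᵐ x, x ∈ interior (hull K.1) →
      weakDiv Ω (fnVec M τ) x = ev (polyDiv (τ K)) x := by
  obtain ⟨hq, hw⟩ := weakDiv_spec hτ
  set q := weakDiv Ω (fnVec M τ)
  have := M.nontrivial hd K
  choose n hn using fun i => exists_isFaceNormal (b := M.basis K) i
  have hsub := M.interior_subset K
  have hfin : volume (interior (hull K.1)) ≠ ⊤ :=
    ((measure_mono _root_.interior_subset).trans_lt (M.isCompact_hull K).measure_lt_top).ne
  have hqi : IntegrableOn q (interior (hull K.1)) := by
    have h2 : MemLp q 2 (volume.restrict (interior (hull K.1))) :=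
      hq.mono_measure (Measure.restrict_mono_set _ hsub)
    have : IsFiniteMeasure (volume.restrict (interior (hull K.1))) := ⟨by simpa using hfin.lt_top⟩
    exact h2.integrable (by norm_num)
  have hpi : IntegrableOn (ev (polyDiv (τ K))) (interior (hull K.1)) :=
    ((continuous_ev _).continuousOn.integrableOn_compact (M.isCompact_hull K)).mono_set
      _root_.interior_subset
  -- Fundamental lemma of the calculus of variations in the open element: for φ supported there, the
  -- weak definition and classical integration by parts are compared. The other elements and all
  -- face terms drop out because φ vanishes on them.
  have key := isOpen_interior.ae_eq_zero_of_integral_contDiff_smul_eq_zero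
    (f := fun x => q x - ev (polyDiv (τ K)) x) (μ := volume) (U := interior (hull K.1))
    (hqi.sub hpi).locallyIntegrableOn ?_
  · filter_upwards [key] with x hx hxK
    exact sub_eq_zero.1 (hx hxK)
  · intro φ h1 h2 h3
    have hφ : IsTest (interior (hull K.1)) φ := ⟨h1, h2, h3⟩
    have e1 := hw φ (hφ.mono hsub)
    rw [(integral_fderiv_fnVec hφ τ).2, Finset.sum_eq_single K] at e1
    rotate_left
    · intro L _ hL
      rw [setIntegral_congr_fun (g := fun _ => (0 : ℝ)) (M.isCompact_hull L).measurableSet]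
      · simp
      · intro x hx
        have : x ∉ interior (hull K.1) :=
          fun h => Set.disjoint_left.1 (M.disjoint_interior hL.symm) h hx
        simp [hφ.fderiv_eq_zero this]
    · simp
    have e2 := integral_simplex_by_parts hn (τ K) (φ := φ) (h1.of_le (by simp))
    rw [← M.hull_eq_simplex, integral_add, Finset.sum_eq_zero] at e2
    rotate_left
    · intro i _
      rw [faceMeasure, setIntegral_congr_fun (g := fun _ => (0 : ℝ))
        (isClosed_face _ i).measurableSet]
      · simp
      · intro x hx
        have : x ∉ interior (hull K.1) := by
          rw [M.interior_hull]
          exact fun h => (h i).ne' hx.1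
        simp [hφ.eq_zero this]
    · exact (hφ.continuous_fderiv_apply _).continuousOn.integrableOn_compact (M.isCompact_hull K)
    · exact (h1.continuous.mul (continuous_ev _)).continuousOn.integrableOn_compact
        (M.isCompact_hull K)
    have e3 : ∫ x in Ω, q x * φ x = ∫ x in interior (hull K.1), q x * φ x :=
      setIntegral_eq_of_subset_of_forall_sdiff_eq_zero M.isOpen.measurableSet hsub
        fun x hx => by simp [hφ.eq_zero hx.2]
    have e4 : ∫ x in hull K.1, φ x * ev (polyDiv (τ K)) x =
        ∫ x in interior (hull K.1), φ x * ev (polyDiv (τ K)) x :=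
      (setIntegral_congr_set (M.interior_ae_eq K)).symm
    have e5 : ∫ x, φ x • (q x - ev (polyDiv (τ K)) x) =
        ∫ x in interior (hull K.1), φ x • (q x - ev (polyDiv (τ K)) x) :=
      (setIntegral_eq_integral_of_forall_compl_eq_zero
        fun x hx => by simp [hφ.eq_zero hx]).symm
    obtain ⟨C, hC⟩ := h2.exists_bound_of_continuous h1.continuous
    have hi1 : IntegrableOn (fun x => φ x * q x) (interior (hull K.1)) :=
      Integrable.bdd_mul hqi h1.continuous.aestronglyMeasurable (.of_forall hC)
    have hi2 : IntegrableOn (fun x => φ x * ev (polyDiv (τ K)) x) (interior (hull K.1)) :=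
      Integrable.bdd_mul hpi h1.continuous.aestronglyMeasurable (.of_forall hC)
    rw [e5]
    simp only [smul_eq_mul, mul_sub]
    rw [integral_sub hi1 hi2, ← e4]
    rw [e3] at e1
    simp_rw [mul_comm (q _)] at e1
    linarith

end WeakDivergence

/-! ### Facets, their two sides, and oriented normals -/

section Facets

variable {d : ℕ} {Ω : Set (Eu d)} {M : Mesh d Ω}

theorem Mesh.facet_card (F : M.facets) : F.1.card = d := by
  obtain ⟨K, -, hF⟩ := Finset.mem_biUnion.1 F.2
  exact (Finset.mem_powersetCard.1 hF).2

open Classical in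
theorem Mesh.erase_mem_facets (K : M.elems) (i : {x // x ∈ K.1}) : K.1.erase i ∈ M.facets := by
  refine Finset.mem_biUnion.2 ⟨K, K.2, Finset.mem_powersetCard.2 ⟨Finset.erase_subset _ _, ?_⟩⟩
  rw [Finset.card_erase_of_mem i.2, M.card_eq K K.2]
  rfl

open Classical in
-- Facets have d vertices and elements d + 1. This connects facets of the mesh with the faces `face`
-- indexed by opposite vertices.
theorem Mesh.exists_eq_erase {K : M.elems} {F : M.facets} (h : F.1 ⊆ K.1) :
    ∃ i : {x // x ∈ K.1}, F.1 = K.1.erase i := by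
  have hc : (K.1 \ F.1).card = 1 := by
    rw [Finset.card_sdiff_of_subset h, M.card_eq K K.2, M.facet_card F]
    omega
  obtain ⟨x, hx⟩ := Finset.card_eq_one.1 hc
  have hxm : x ∈ K.1 \ F.1 := by rw [hx]; simp
  refine ⟨⟨x, (Finset.mem_sdiff.1 hxm).1⟩, ?_⟩
  change F.1 = K.1.erase x
  rw [Finset.erase_eq, ← hx, Finset.sdiff_sdiff_eq_self h]

/-- The points that lie strictly on the inner side of all faces through the vertex `b i`. -/
def sideRegion {V : Type*} [NormedAddCommGroup V] [InnerProductSpace ℝ V] {ι : Type*}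
    (b : AffineBasis ι ℝ V) (i : ι) : Set V := {x | ∀ j, j ≠ i → 0 < b.coord j x}

theorem isOpen_sideRegion {V : Type*} [NormedAddCommGroup V] [InnerProductSpace ℝ V]
    [FiniteDimensional ℝ V] {ι : Type*} [Finite ι] (b : AffineBasis ι ℝ V) (i : ι) :
    IsOpen (sideRegion b i) := by
  simp only [sideRegion, Set.ofPred_forall]
  exact isOpen_iInter_of_finite fun j => isOpen_iInter_of_finite fun _ =>
    isOpen_lt continuous_const (continuous_coord b j)

open Classical in
/-- The barycenter of a facet. -/
theorem Mesh.exists_mem_sideRegion (hd : 2 ≤ d) (F : M.facets) : ∃ x, ∀ (K : M.elems)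
    (i : {x // x ∈ K.1}), F.1 = K.1.erase i →
      x ∈ sideRegion (M.basis K) i ∧ (M.basis K).coord i x = 0 := by
  have hd0 : (0 : ℝ) < d := by positivity
  -- The barycenter depends on F alone, so one point serves every element containing F.
  refine ⟨∑ y ∈ F.1, (d : ℝ)⁻¹ • y, fun K i hF => ?_⟩
  have hw : ∑ j : {x // x ∈ K.1}, (if j = i then (0 : ℝ) else (d : ℝ)⁻¹) = 1 := by
    rw [← Finset.add_sum_erase _ _ (Finset.mem_univ i), if_pos rfl, zero_add,
      Finset.sum_congr rfl (g := fun _ => (d : ℝ)⁻¹) fun j hj => if_neg (Finset.ne_of_mem_erase hj),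
      Finset.sum_const, Finset.card_erase_of_mem (Finset.mem_univ i), Finset.card_univ,
      Fintype.card_coe, M.card_eq K K.2, nsmul_eq_mul]
    simp [hd0.ne']
  have hx : ∑ y ∈ F.1, (d : ℝ)⁻¹ • y = Finset.univ.affineCombination ℝ (M.basis K)
      fun j => if j = i then (0 : ℝ) else (d : ℝ)⁻¹ := by
    rw [Finset.affineCombination_eq_linear_combination _ _ _ hw, hF]
    simp only [Mesh.basis_apply, ite_smul, zero_smul]
    have h1 : ∑ j : {x // x ∈ K.1}, (if j = i then (0 : Eu d) else (d : ℝ)⁻¹ • (j : Eu d)) =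
        ∑ y ∈ K.1, if y = i then (0 : Eu d) else (d : ℝ)⁻¹ • y := by
      rw [← Finset.sum_coe_sort K.1 fun y => if y = i then (0 : Eu d) else (d : ℝ)⁻¹ • y]
      refine Finset.sum_congr rfl fun j _ => ?_
      by_cases h : j = i
      · rw [if_pos h, if_pos (congrArg _ h)]
      · rw [if_neg h, if_neg fun e => h (Subtype.ext e)]
    rw [h1, ← Finset.add_sum_erase _ _ i.2, if_pos rfl, zero_add]
    exact Finset.sum_congr rfl fun y hy => (if_neg (Finset.ne_of_mem_erase hy)).symm
  rw [hx]
  refine ⟨fun j hj => ?_, ?_⟩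
  · rw [(M.basis K).coord_apply_combination_of_mem (Finset.mem_univ j) hw, if_neg hj]
    positivity
  · rw [(M.basis K).coord_apply_combination_of_mem (Finset.mem_univ i) hw, if_pos rfl]

open Classical in
/-- Different elements lie on different sides of a common facet. -/
theorem Mesh.eq_of_isFaceNormal (hd : 2 ≤ d) {F : M.facets} {K L : M.elems} {i : {x // x ∈ K.1}}
    {j : {x // x ∈ L.1}} (hi : F.1 = K.1.erase i) (hj : F.1 = L.1.erase j) {n : Eu d}
    (hK : IsFaceNormal (M.basis K) i n) (hL : IsFaceNormal (M.basis L) j n) : K = L := by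
  by_contra hne
  obtain ⟨x, hx⟩ := M.exists_mem_sideRegion hd F
  have hcont : Continuous fun ε : ℝ => x - ε • n := by fun_prop
  -- A small step from the barycenter against an outer normal enters the interior of the element.
  -- With a common outer normal both interiors would be entered at once, contradicting disjointness.
  have hmem : ∀ (K : M.elems) (i : {x // x ∈ K.1}), F.1 = K.1.erase i →
      IsFaceNormal (M.basis K) i n →
      ∀ᶠ ε in nhdsWithin (0 : ℝ) (Set.Ioi 0), x - ε • n ∈ interior (hull K.1) := by
    intro K i hi hK
    have h1 : ∀ᶠ ε in nhds (0 : ℝ), x - ε • n ∈ sideRegion (M.basis K) i := by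
      refine hcont.continuousAt.eventually_mem ((isOpen_sideRegion _ i).mem_nhds ?_)
      simpa using (hx K i hi).1
    filter_upwards [nhdsWithin_le_nhds h1, self_mem_nhdsWithin] with ε h2 h3
    rw [M.interior_hull]
    intro l
    by_cases hl : l = i
    · obtain ⟨hn, c, hc, h⟩ := hK
      have h4 := h (x - ε • n) x
      rw [(hx K i hi).2, sub_sub_cancel_left, inner_neg_right, inner_smul_right,
        real_inner_self_eq_norm_sq, hn] at h4
      rw [hl]
      have h5 : (0 : ℝ) < ε := h3
      by_contra h6
      nlinarith
    · exact h2 l hl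
  obtain ⟨ε, h1, h2⟩ := ((hmem K i hi hK).and (hmem L j hj hL)).exists
  exact Set.disjoint_left.1 (M.disjoint_interior hne) h1 (_root_.interior_subset h2)

open Classical in
/-- A unit normal of a facet is an outer normal of any element containing it, up to its sign. -/
theorem Mesh.isFaceNormal_or_neg (hd : 2 ≤ d) {F : M.facets} {K : M.elems} {i : {x // x ∈ K.1}}
    (hi : F.1 = K.1.erase i) {n : Eu d} (hn : ‖n‖ = 1)
    (hF : ∀ x ∈ F.1, ∀ y ∈ F.1, inner ℝ n (x - y) = 0) :
    IsFaceNormal (M.basis K) i n ∨ IsFaceNormal (M.basis K) i (-n) := by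
  have := M.nontrivial hd K
  have hmem : ∀ j : {x // x ∈ K.1}, j ≠ i → j.1 ∈ F.1 := fun j hj => by
    rw [hi]; exact Finset.mem_erase.2 ⟨fun h => hj (Subtype.ext h), j.2⟩
  obtain ⟨k, hk⟩ := exists_ne i
  have h := inner_eq_coord (b := M.basis K) (i := i) (n := n)
    (fun j l hj hl => hF _ (hmem j hj) _ (hmem l hl)) hk
  set c := inner ℝ n (M.basis K i - M.basis K k) with hc
  -- The sign of c tells on which side of F the opposite vertex lies; c = 0 would make n orthogonal
  -- to itself.
  rcases lt_trichotomy c 0 with h1 | h1 | h1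
  · exact .inl ⟨hn, -c, by linarith, fun x y => by rw [h]; ring⟩
  · have h2 := h n 0
    rw [h1, sub_zero, real_inner_self_eq_norm_sq, hn] at h2
    norm_num at h2
  · exact .inr ⟨by rwa [norm_neg], c, h1, fun x y => by rw [inner_neg_left, h]; ring⟩

theorem Mesh.integrable_facet (hd : 2 ≤ d) (F : M.facets) {g : Eu d → ℝ}
    (hg : Continuous g) : Integrable g (facetMeasure F.1) := by
  classical
  obtain ⟨K, hK, hF⟩ := Finset.mem_biUnion.1 F.2
  obtain ⟨i, hi⟩ := M.exists_eq_erase (K := ⟨K, hK⟩) (Finset.mem_powersetCard.1 hF).1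
  have := M.nontrivial hd ⟨K, hK⟩
  obtain ⟨j, hj⟩ := exists_ne i
  obtain ⟨n, hn⟩ := exists_isFaceNormal (b := M.basis ⟨K, hK⟩) i
  rw [hi, M.facetMeasure_erase]
  exact hn.integrable hj.symm hg

variable (S : Skeleton M)

open Classical in
/-- The unit normal of the facet `F` that points out of the element `K`. -/
def Skeleton.outNormal (K : M.elems) (F : M.facets) : Eu d :=
  if K = S.minus F then S.normal F else -S.normal F

open Classical in
-- For K_F^- this is the orientation stored in the skeleton. For any other element containing F, the
-- vector n_F cannot be outward, since that would force the element to be K_F^-; hence -n_F is.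
theorem Skeleton.isFaceNormal_outNormal (hd : 2 ≤ d) {K : M.elems} {F : M.facets}
    {i : {x // x ∈ K.1}} (hi : F.1 = K.1.erase i) :
    IsFaceNormal (M.basis K) i (S.outNormal K F) := by
  obtain ⟨hn, hF, hout⟩ := S.minus_normal F
  have hminus : ∀ l : {x // x ∈ (S.minus F).1}, F.1 = (S.minus F).1.erase l →
      IsFaceNormal (M.basis (S.minus F)) l (S.normal F) := by
    intro l hl
    refine (M.isFaceNormal_or_neg hd hl hn hF).resolve_right ?_
    rintro ⟨-, c, hc, h⟩
    have := M.nontrivial hd (S.minus F)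
    obtain ⟨k, hk⟩ := exists_ne l
    have hkF : k.1 ∈ F.1 := by
      rw [hl]; exact Finset.mem_erase.2 ⟨fun h => hk (Subtype.ext h), k.2⟩
    have h1 := hout k hkF l l.2 (by rw [hl]; exact Finset.notMem_erase _ _)
    have h2 := h l k
    rw [← M.basis_apply, ← M.basis_apply, (M.basis _).coord_apply_eq,
      (M.basis _).coord_apply_ne hk.symm, inner_neg_left] at h2
    simp only [Mesh.basis_apply] at h2
    linarith
  by_cases hK : K = S.minus F
  · subst hK
    rw [outNormal, if_pos rfl]
    exact hminus i hi
  · rw [outNormal, if_neg hK]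
    refine (M.isFaceNormal_or_neg hd hi hn hF).resolve_left fun h => hK ?_
    obtain ⟨l, hl⟩ := M.exists_eq_erase (S.minus_sub F)
    exact M.eq_of_isFaceNormal hd hi hl h (hminus l hl)

/-- Both elements have outer normal -n_F on F, so they coincide. Hence at most two elements share a
facet. -/
theorem Skeleton.eq_of_ne_minus (hd : 2 ≤ d) {K L : M.elems} {F : M.facets} (hK : F.1 ⊆ K.1)
    (hL : F.1 ⊆ L.1) (hK' : K ≠ S.minus F) (hL' : L ≠ S.minus F) : K = L := by
  obtain ⟨i, hi⟩ := M.exists_eq_erase hK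
  obtain ⟨j, hj⟩ := M.exists_eq_erase hL
  have h1 := S.isFaceNormal_outNormal hd hi
  have h2 := S.isFaceNormal_outNormal hd hj
  rw [outNormal, if_neg hK'] at h1
  rw [outNormal, if_neg hL'] at h2
  exact M.eq_of_isFaceNormal hd hi hj h1 h2

theorem Skeleton.eq_plus (hd : 2 ≤ d) {K : M.elems} {F : M.facets} (hF : M.IsInterior F)
    (hK : F.1 ⊆ K.1) (hK' : K ≠ S.minus F) : K = S.plus F :=
  S.eq_of_ne_minus hd hK (S.plus_sub F hF).1 hK' (S.plus_sub F hF).2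

theorem Skeleton.eq_minus {K : M.elems} {F : M.facets} (hF : ¬ M.IsInterior F)
    (hK : F.1 ⊆ K.1) : K = S.minus F := by
  by_contra h
  exact hF ⟨K, S.minus F, h, hK, S.minus_sub F⟩

open Classical in
/-- Integration by parts on an element of the mesh. -/
theorem Skeleton.integral_hull_by_parts (hd : 2 ≤ d) (K : M.elems) (τ : PolyVec d)
    {φ : Eu d → ℝ} (hφ : ContDiff ℝ 1 φ) :
    ∫ x in hull K.1, (fderiv ℝ φ x (evVec τ x) + φ x * ev (polyDiv τ) x) =
      ∑ F : M.facets with F.1 ⊆ K.1,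
        ∫ y, φ y * inner ℝ (evVec τ y) (S.outNormal K F) ∂(facetMeasure F.1) := by
  have := M.nontrivial hd K
  rw [M.hull_eq_simplex, integral_simplex_by_parts
    (n := fun i : {x // x ∈ K.1} => S.outNormal K ⟨K.1.erase i, M.erase_mem_facets K i⟩)
    (fun i => S.isFaceNormal_outNormal hd rfl) τ hφ]
  refine Finset.sum_bij (fun i _ => ⟨K.1.erase i, M.erase_mem_facets K i⟩) ?_ ?_ ?_ ?_
  · intro i _
    simp only [Finset.mem_filter, Finset.mem_univ, true_and]
    exact Finset.erase_subset _ _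
  · intro i _ j _ h
    exact Subtype.ext (Finset.erase_injOn K.1 i.2 j.2 (Subtype.ext_iff.1 h))
  · intro F hF
    obtain ⟨i, hi⟩ := M.exists_eq_erase (Finset.mem_filter.1 hF).2
    exact ⟨i, Finset.mem_univ _, Subtype.ext hi.symm⟩
  · intro i _
    rw [M.facetMeasure_erase]

end Facets

/-! ### Continuity of normal components and Green's formula -/

section GreenFormula

variable {d : ℕ} {Ω : Set (Eu d)} {M : Mesh d Ω}

theorem sum_integral_eq_zero (hd : 2 ≤ d) {τ : M.elems → PolyVec d} (hτ : MemHdiv Ω (fnVec M τ))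
    {φ : Eu d → ℝ} (hφ : IsTest Ω φ) :
    ∑ K : M.elems, ∫ x in hull K.1,
      (fderiv ℝ φ x (evVec (τ K) x) + φ x * ev (polyDiv (τ K)) x) = 0 := by
  have h1 := (weakDiv_spec hτ).2 φ hφ
  have h2 := (M.setIntegral_eq_sum_of_ae (h := fun x => weakDiv Ω (fnVec M τ) x * φ x)
    (h' := fun K x => φ x * ev (polyDiv (τ K)) x)
    (fun K => hφ.1.continuous.mul (continuous_ev _)) (fun K => by
      filter_upwards [weakDiv_ae_eq hd hτ K] with x hx hxK
      rw [hx hxK, mul_comm])).2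
  rw [h2, (integral_fderiv_fnVec hφ τ).2] at h1
  have h3 : ∀ K : M.elems, ∫ x in hull K.1,
      (fderiv ℝ φ x (evVec (τ K) x) + φ x * ev (polyDiv (τ K)) x) =
      (∫ x in hull K.1, fderiv ℝ φ x (evVec (τ K) x)) +
        ∫ x in hull K.1, φ x * ev (polyDiv (τ K)) x := fun K => integral_add
    ((hφ.continuous_fderiv_apply (τ K)).continuousOn.integrableOn_compact (M.isCompact_hull K))
    ((hφ.1.continuous.mul (continuous_ev _)).continuousOn.integrableOn_compact
      (M.isCompact_hull K))
  rw [Finset.sum_congr rfl fun K _ => h3 K, Finset.sum_add_distrib, h1]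
  ring

open Classical in
-- Up to a null set, a facet equals its relative interior, because its own boundary has codimension
-- two.
theorem Mesh.ae_mem_sideRegion (hd : 2 ≤ d) {F : M.facets} {K : M.elems} {i : {x // x ∈ K.1}}
    (hi : F.1 = K.1.erase i) :
    ∀ᵐ x ∂(facetMeasure F.1), x ∈ sideRegion (M.basis K) i := by
  have := M.nontrivial hd K
  obtain ⟨n, hn⟩ := exists_isFaceNormal (b := M.basis K) i
  rw [hi, M.facetMeasure_erase]
  have h1 : ∀ᵐ x ∂(faceMeasure (M.basis K) i), x ∈ face (M.basis K) i :=
    ae_restrict_mem (isClosed_face _ i).measurableSet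
  have h2 : ∀ l, ∀ᵐ x ∂(faceMeasure (M.basis K) i), l ≠ i → (M.basis K).coord l x ≠ 0 := by
    intro l
    by_cases hl : l = i
    · simp [hl]
    -- A third vertex exists because d + 1 ≥ 3; it supplies the transversal edge for slicing.
    obtain ⟨m, -, hm⟩ := Finset.exists_mem_notMem_of_card_lt_card (s := {i, l})
      (t := (Finset.univ : Finset {x // x ∈ K.1})) (by
        rw [Finset.card_univ, Fintype.card_coe, M.card_eq K K.2]
        exact Finset.card_le_two.trans_lt (by omega))
    simp only [Finset.mem_insert, Finset.mem_singleton, not_or] at hm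
    have h3 := hn.faceMeasure_coord_eq_zero (Ne.symm hl) (Ne.symm hm.1) (Ne.symm hm.2)
    filter_upwards [measure_eq_zero_iff_ae_notMem.1 h3] with x hx _ using hx
  filter_upwards [h1, ae_all_iff.2 h2] with x hx hx' l hl
  exact lt_of_le_of_ne (hx.2 l) (hx' l hl).symm

variable (S : Skeleton M)

/-- The normal components of a field of `H(div; Ω)` are continuous across interior facets. -/
theorem Skeleton.normal_continuous (hd : 2 ≤ d) {τ : M.elems → PolyVec d}
    (hτ : MemHdiv Ω (fnVec M τ)) {F : M.facets} (hF : M.IsInterior F) :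
    ∀ᵐ x ∂(facetMeasure F.1), inner ℝ (evVec (τ (S.plus F)) x) (S.normal F) =
      inner ℝ (evVec (τ (S.minus F)) x) (S.normal F) := by
  classical
  set K := S.minus F with hKdef
  set L := S.plus F with hLdef
  obtain ⟨hLF, hne⟩ := S.plus_sub F hF
  have hKF := S.minus_sub F
  obtain ⟨i, hi⟩ := M.exists_eq_erase hKF
  obtain ⟨j, hj⟩ := M.exists_eq_erase hLF
  have hnK := S.isFaceNormal_outNormal hd hi
  have hnL := S.isFaceNormal_outNormal hd hj
  rw [outNormal, if_pos rfl] at hnK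
  rw [outNormal, if_neg hne] at hnL
  -- W is an open neighbourhood of the relative interior of F that lies in K ∪ L and avoids all
  -- other elements and all other facets of K and L.
  set W := sideRegion (M.basis K) i ∩ sideRegion (M.basis L) j with hW
  have hWo : IsOpen W := (isOpen_sideRegion _ i).inter (isOpen_sideRegion _ j)
  have hWsub : ∀ x ∈ W, x ∈ hull K.1 ∨ x ∈ hull L.1 := by
    intro x hx
    obtain ⟨y, hy⟩ := M.exists_mem_sideRegion hd F
    obtain ⟨-, c, hc, h1⟩ := hnK
    obtain ⟨-, c', hc', h2⟩ := hnL
    have h1 := h1 x y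
    have h2 := h2 x y
    rw [(hy K i hi).2] at h1
    rw [(hy L j hj).2, inner_neg_left, h1] at h2
    rw [M.hull_eq_simplex, M.hull_eq_simplex]
    -- The outer normals of K and L on F are opposite, so a point of W outside K is on the inner
    -- side of L.
    rcases le_or_gt 0 ((M.basis K).coord i x) with h | h
    · refine .inl fun l => ?_
      by_cases hl : l = i
      · rwa [hl]
      · exact (hx.1 l hl).le
    · refine .inr fun l => ?_
      by_cases hl : l = j
      · rw [hl]
        by_contra h'
        nlinarith
      · exact (hx.2 l hl).le
  have hWΩ : W ⊆ Ω := by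
    rw [M.fills]
    refine interior_maximal (fun x hx => ?_) hWo
    rcases hWsub x hx with h | h
    · exact Set.mem_biUnion K.2 h
    · exact Set.mem_biUnion L.2 h
  have hother : ∀ N : M.elems, N ≠ K → N ≠ L → ∀ x ∈ hull N.1, x ∉ W := by
    intro N hNK hNL x hx hxW
    -- At most two elements contain F, so N misses a vertex l of F. The coordinate of l vanishes on
    -- the intersection with N but is positive on W.
    have hFN : ¬ F.1 ⊆ N.1 := fun h => hNL (S.eq_plus hd hF h hNK)
    obtain ⟨l, hl, hlN⟩ := Finset.not_subset.1 hFN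
    rcases hWsub x hxW with h | h
    · have h1 := M.coord_eq_zero_of_mem_inter (i := ⟨l, hKF hl⟩) hlN h hx
      refine (hxW.1 ⟨l, hKF hl⟩ fun e => ?_).ne' h1
      rw [hi, ← e] at hl
      exact Finset.notMem_erase _ _ hl
    · have h1 := M.coord_eq_zero_of_mem_inter (i := ⟨l, hLF hl⟩) hlN h hx
      refine (hxW.2 ⟨l, hLF hl⟩ fun e => ?_).ne' h1
      rw [hj, ← e] at hl
      exact Finset.notMem_erase _ _ hl
  have hparts : ∀ (N : M.elems) (i : {x // x ∈ N.1}), F.1 = N.1.erase i →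
      W ⊆ sideRegion (M.basis N) i → ∀ φ, IsTest W φ →
      ∫ x in hull N.1, (fderiv ℝ φ x (evVec (τ N) x) + φ x * ev (polyDiv (τ N)) x) =
        ∫ y, φ y * inner ℝ (evVec (τ N) y) (S.outNormal N F) ∂(facetMeasure F.1) := by
    intro N i hi hWN φ hφ
    rw [S.integral_hull_by_parts hd N (τ N) (hφ.1.of_le (by simp)), Finset.sum_eq_single F]
    · intro F' hF' hne
      obtain ⟨l, hl⟩ := M.exists_eq_erase (Finset.mem_filter.1 hF').2
      have hli : l ≠ i := fun e => hne (Subtype.ext (by rw [hl, hi, e]))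
      rw [hl, M.facetMeasure_erase, faceMeasure, setIntegral_congr_fun (g := fun _ => (0 : ℝ))
        (isClosed_face _ l).measurableSet]
      · simp
      · intro x hx
        have : x ∉ W := fun h => (hWN h l hli).ne' hx.1
        simp [hφ.eq_zero this]
    · intro h
      refine absurd (Finset.mem_filter.2 ⟨Finset.mem_univ _, ?_⟩) h
      rw [hi]
      exact Finset.erase_subset _ _
  have hcont : ∀ N : M.elems, Continuous fun x => inner ℝ (evVec (τ N) x) (S.normal F) :=
    fun N => (continuous_evVec _).inner continuous_const
  -- The fundamental lemma again, now for surface measure: testing with φ supported in W leaves only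
  -- the two contributions of F, with opposite normals.
  have key := hWo.ae_eq_zero_of_integral_contDiff_smul_eq_zero (μ := facetMeasure F.1)
    (f := fun x => inner ℝ (evVec (τ K) x) (S.normal F) - inner ℝ (evVec (τ L) x) (S.normal F))
    (M.integrable_facet hd F ((hcont K).sub (hcont L))).integrableOn.locallyIntegrableOn ?_
  · filter_upwards [key, M.ae_mem_sideRegion hd hi, M.ae_mem_sideRegion hd hj] with x h1 h2 h3
    exact (sub_eq_zero.1 (h1 ⟨h2, h3⟩)).symm
  · intro φ h1 h2 h3
    have hφ : IsTest W φ := ⟨h1, h2, h3⟩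
    have h0 := sum_integral_eq_zero hd hτ (hφ.mono hWΩ)
    rw [Finset.sum_eq_add K L hne.symm, hparts K i hi Set.inter_subset_left φ hφ,
      hparts L j hj Set.inter_subset_right φ hφ, outNormal, outNormal, if_pos rfl, if_neg hne] at h0
    · simp only [smul_eq_mul, mul_sub]
      have hi : ∀ N : M.elems, Integrable
          (fun x => φ x * inner ℝ (evVec (τ N) x) (S.normal F)) (facetMeasure F.1) :=
        fun N => M.integrable_facet hd F (h1.continuous.mul (hcont N))
      rw [integral_sub (hi K) (hi L)]
      simp only [inner_neg_right, mul_neg, integral_neg] at h0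
      linarith
    · rintro N - ⟨hNK, hNL⟩
      rw [setIntegral_congr_fun (g := fun _ => (0 : ℝ)) (M.isCompact_hull N).measurableSet]
      · simp
      · intro x hx
        have := hother N hNK hNL x hx
        simp [hφ.fderiv_eq_zero this, hφ.eq_zero this]
    · simp
    · simp

theorem integral_weakDiv_mul_eq_sum (hd : 2 ≤ d) {τ : M.elems → PolyVec d}
    (hτ : MemHdiv Ω (fnVec M τ)) (v : M.elems → Poly d) :
    IntegrableOn (fun x => weakDiv Ω (fnVec M τ) x * fn M v x) Ω ∧
    ∫ x in Ω, weakDiv Ω (fnVec M τ) x * fn M v x =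
      ∑ K : M.elems, ∫ x in hull K.1, ev (v K) x * ev (polyDiv (τ K)) x :=
  M.setIntegral_eq_sum_of_ae (h' := fun K x => ev (v K) x * ev (polyDiv (τ K)) x)
    (fun K => (continuous_ev _).mul (continuous_ev _)) fun K => by
      filter_upwards [weakDiv_ae_eq hd hτ K] with x hx hxK
      rw [hx hxK, fn, glue_eq _ hxK, mul_comm]

/-- Green's formula for piecewise polynomials and Raviart-Thomas fields. -/
theorem Skeleton.integral_weakDiv_mul (hd : 2 ≤ d) {τ : M.elems → PolyVec d}
    (hτ : MemHdiv Ω (fnVec M τ)) (v : M.elems → Poly d) :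
    ∫ x in Ω, weakDiv Ω (fnVec M τ) x * fn M v x =
      -(∑ K : M.elems, ∫ x in hull K.1, inner ℝ (evVec (τ K) x) (evVec (grad (v K)) x)) +
        ∑ F : M.facets, ∫ x, normalTrace S τ F x * jump S v F x ∂(facetMeasure F.1) := by
  classical
  rw [(integral_weakDiv_mul_eq_sum hd hτ v).2]
  have hK : ∀ K : M.elems, ∫ x in hull K.1, ev (v K) x * ev (polyDiv (τ K)) x =
      -(∫ x in hull K.1, inner ℝ (evVec (τ K) x) (evVec (grad (v K)) x)) +
        ∑ F : M.facets with F.1 ⊆ K.1,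
          ∫ y, ev (v K) y * inner ℝ (evVec (τ K) y) (S.outNormal K F) ∂(facetMeasure F.1) := by
    intro K
    rw [← S.integral_hull_by_parts hd K (τ K) ((contDiff_ev (v K)).of_le (by simp))]
    simp_rw [fderiv_ev]
    rw [integral_add]
    · ring
    · exact ((continuous_evVec _).inner (continuous_evVec _)).continuousOn.integrableOn_compact
        (M.isCompact_hull K)
    · exact ((continuous_ev _).mul (continuous_ev _)).continuousOn.integrableOn_compact
        (M.isCompact_hull K)
  rw [Finset.sum_congr rfl fun K _ => hK K, Finset.sum_add_distrib, Finset.sum_neg_distrib]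
  congr 1
  -- Regroup by facets: an interior facet receives one term from each side, a boundary facet a
  -- single term.
  rw [Finset.sum_comm' (t' := Finset.univ)
    (s' := fun F : M.facets => {K : M.elems | F.1 ⊆ K.1}) (by simp)]
  refine Finset.sum_congr rfl fun F _ => ?_
  have hcont : ∀ N : M.elems, Continuous fun x =>
      ev (v N) x * inner ℝ (evVec (τ N) x) (S.normal F) :=
    fun N => (continuous_ev _).mul ((continuous_evVec _).inner continuous_const)
  by_cases hF : M.IsInterior F
  · have hne := (S.plus_sub F hF).2
    have hset : ({K : M.elems | F.1 ⊆ K.1} : Finset M.elems) = {S.minus F, S.plus F} := by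
      ext K
      simp only [Finset.mem_filter, Finset.mem_univ, true_and, Finset.mem_insert,
        Finset.mem_singleton]
      constructor
      · intro h
        by_cases hK' : K = S.minus F
        · exact .inl hK'
        · exact .inr (S.eq_plus hd hF h hK')
      · rintro (rfl | rfl)
        · exact S.minus_sub F
        · exact (S.plus_sub F hF).1
    rw [hset, Finset.sum_pair hne.symm, outNormal, outNormal, if_pos rfl, if_neg hne]
    simp only [inner_neg_right, mul_neg, integral_neg]
    rw [← sub_eq_add_neg, ← integral_sub (M.integrable_facet hd F (hcont _))
      (M.integrable_facet hd F (hcont _))]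
    refine integral_congr_ae ?_
    -- Because the normal component is single-valued, the two terms combine into τ·n_F times the
    -- jump.
    filter_upwards [S.normal_continuous hd hτ hF] with x hx
    rw [hx, normalTrace, jump, if_pos hF]
    ring
  · have hset : ({K : M.elems | F.1 ⊆ K.1} : Finset M.elems) = {S.minus F} := by
      ext K
      simp only [Finset.mem_filter, Finset.mem_univ, true_and, Finset.mem_singleton]
      exact ⟨S.eq_minus hF, by rintro rfl; exact S.minus_sub F⟩
    rw [hset, Finset.sum_singleton, outNormal, if_pos rfl]
    simp only [normalTrace, jump, if_neg hF, mul_comm]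

end GreenFormula

/-! ### Degrees, sums of fluxes, and moments of the divergence -/

section FluxMoments

variable {d : ℕ} {Ω : Set (Eu d)} {M : Mesh d Ω}

theorem measurableSet_hull (F : Finset (Eu d)) : MeasurableSet (hull F) := by
  have h : IsCompact (hull F) := F.finite_toSet.isCompact_convexHull ℝ
  exact h.measurableSet

/-- In degree 0 the bound of `totalDegree_pderiv_le` truncates to 0 and is too weak; here the
derivative must vanish. -/
theorem pderiv_eq_zero {p : Poly d} (h : p.totalDegree ≤ 0) (i : Fin d) :
    MvPolynomial.pderiv i p = 0 := by
  rw [MvPolynomial.totalDegree_eq_zero_iff_eq_C.1 (Nat.le_zero.1 h), MvPolynomial.pderiv_C]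

theorem totalDegree_pderiv_le {p : Poly d} {k : ℕ} (h : p.totalDegree ≤ k) (i : Fin d) :
    (MvPolynomial.pderiv i p).totalDegree ≤ k - 1 := by
  rw [p.as_sum, map_sum]
  refine MvPolynomial.totalDegree_finsetSum_le fun s hs => ?_
  rw [MvPolynomial.pderiv_monomial]
  by_cases h0 : s i = 0
  · simp [h0]
  refine (MvPolynomial.totalDegree_monomial_le _ _).trans ?_
  have h1 : (s.sum fun _ e => e) ≤ k := (MvPolynomial.le_totalDegree hs).trans h
  have h2 : s = (s - Finsupp.single i 1) + Finsupp.single i 1 :=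
    (tsub_add_cancel_of_le (Finsupp.single_le_iff.2 (Nat.one_le_iff_ne_zero.2 h0))).symm
  rw [h2, Finsupp.sum_add_index' (fun _ => rfl) (fun _ _ _ => rfl), Finsupp.sum_single_index rfl]
    at h1
  change (s - Finsupp.single i 1).sum (fun _ e => e) ≤ k - 1
  omega

/-- Although x b may have degree k + 1, its divergence d b + x·∇b has degree at most k. -/
theorem totalDegree_polyDiv_le {τ : PolyVec d} {k : ℕ} (h : τ ∈ RTLocal d k) :
    (polyDiv τ).totalDegree ≤ k := by
  obtain ⟨a, b, ha, hb, h⟩ := h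
  refine MvPolynomial.totalDegree_finsetSum_le fun i _ => ?_
  rw [h i, map_add, Derivation.leibniz, MvPolynomial.pderiv_X_self, smul_eq_mul, smul_eq_mul,
    mul_one]
  refine (MvPolynomial.totalDegree_add _ _).trans (max_le ?_ ?_)
  · exact (totalDegree_pderiv_le (ha i) i).trans (Nat.sub_le _ _)
  refine (MvPolynomial.totalDegree_add _ _).trans (max_le ?_ hb)
  rcases Nat.eq_zero_or_pos k with rfl | hk
  · rw [pderiv_eq_zero hb, mul_zero, MvPolynomial.totalDegree_zero]
  · refine (MvPolynomial.totalDegree_mul _ _).trans ?_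
    have := totalDegree_pderiv_le hb i
    rw [MvPolynomial.totalDegree_X]
    omega

theorem RTLocal_add {σ τ : PolyVec d} {k : ℕ} (hσ : σ ∈ RTLocal d k) (hτ : τ ∈ RTLocal d k) :
    σ + τ ∈ RTLocal d k := by
  obtain ⟨a, b, ha, hb, h⟩ := hσ
  obtain ⟨a', b', ha', hb', h'⟩ := hτ
  refine ⟨a + a', b + b', fun i => ?_, ?_, fun i => ?_⟩
  · exact (MvPolynomial.totalDegree_add _ _).trans (max_le (ha i) (ha' i))
  · exact (MvPolynomial.totalDegree_add _ _).trans (max_le hb hb')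
  · rw [Pi.add_apply, Pi.add_apply, h, h']
    ring

theorem polyDiv_add (σ τ : PolyVec d) : polyDiv (σ + τ) = polyDiv σ + polyDiv τ := by
  simp [polyDiv, Finset.sum_add_distrib]

theorem evVec_add (σ τ : PolyVec d) (x : Eu d) : evVec (σ + τ) x = evVec σ x + evVec τ x := by
  ext i
  simp [evVec, ev_add]

theorem fnVec_add (σ τ : M.elems → PolyVec d) : fnVec M (σ + τ) = fnVec M σ + fnVec M τ := by
  classical
  ext1 x
  rw [Pi.add_apply, fnVec, fnVec, fnVec, glue, glue, glue, ← Finset.sum_add_distrib]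
  refine Finset.sum_congr rfl fun K _ => ?_
  by_cases hx : x ∈ interior (hull K.1)
  · simp only [Set.indicator_of_mem hx, Pi.add_apply, evVec_add]
  · simp only [Set.indicator_of_notMem hx, add_zero]

theorem memHdiv_add {σ τ : M.elems → PolyVec d} (hσ : MemHdiv Ω (fnVec M σ))
    (hτ : MemHdiv Ω (fnVec M τ)) : MemHdiv Ω (fnVec M (σ + τ)) := by
  rw [fnVec_add]
  obtain ⟨h1, q1, hq1, e1⟩ := hσ
  obtain ⟨h2, q2, hq2, e2⟩ := hτ
  refine ⟨h1.add h2, q1 + q2, hq1.add hq2, fun φ hφ => ?_⟩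
  have hφ2 : MemLp φ 2 (volume.restrict Ω) :=
    (hφ.1.continuous.memLp_of_hasCompactSupport hφ.2.1).restrict Ω
  have i1 : Integrable (fun x => q1 x * φ x) (volume.restrict Ω) := hq1.integrable_mul hφ2
  have i2 : Integrable (fun x => q2 x * φ x) (volume.restrict Ω) := hq2.integrable_mul hφ2
  simp only [Pi.add_apply, map_add, add_mul]
  rw [integral_add (integral_fderiv_fnVec hφ σ).1 (integral_fderiv_fnVec hφ τ).1, e1 φ hφ, e2 φ hφ,
    integral_add i1 i2, neg_add]

theorem RT_add {σ τ : M.elems → PolyVec d} {k : ℕ} (hσ : σ ∈ RT M k) (hτ : τ ∈ RT M k) :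
    σ + τ ∈ RT M k :=
  ⟨fun K => RTLocal_add (hσ.1 K) (hτ.1 K), memHdiv_add hσ.2 hτ.2⟩

theorem memLp_fn (v : M.elems → Poly d) : MemLp (fn M v) 2 (volume.restrict Ω) := by
  refine MemLp.restrict Ω ?_
  change MemLp (fun x => ∑ K : M.elems, (interior (hull K.1)).indicator (ev (v K)) x) 2 volume
  refine memLp_finsetSum _ fun K _ => ?_
  rw [memLp_indicator_iff_restrict isOpen_interior.measurableSet]
  refine MemLp.mono_measure (Measure.restrict_mono_set _ interior_subset)
    (?_ : MemLp _ 2 (volume.restrict (hull K.1)))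
  have : IsFiniteMeasure (volume.restrict (hull K.1)) :=
    ⟨by simpa using (M.isCompact_hull K).measure_lt_top⟩
  obtain ⟨C, hC⟩ := (M.isCompact_hull K).exists_bound_of_continuousOn
    (continuous_ev (v K)).continuousOn
  refine MemLp.of_bound (continuous_ev (v K)).aestronglyMeasurable C ?_
  filter_upwards [ae_restrict_mem (M.isCompact_hull K).measurableSet] with x hx using hC x hx

theorem weakDiv_ae_fn (hd : 2 ≤ d) {τ : M.elems → PolyVec d} (hτ : MemHdiv Ω (fnVec M τ)) :
    weakDiv Ω (fnVec M τ) =ᵐ[volume.restrict Ω] fn M fun K => polyDiv (τ K) := by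
  rw [Filter.EventuallyEq, Measure.restrict_congr_set M.ae_eq_iUnion, ae_restrict_iff'
    (MeasurableSet.iUnion fun K => isOpen_interior.measurableSet)]
  filter_upwards [ae_all_iff.2 (weakDiv_ae_eq hd hτ)] with x hx hxU
  obtain ⟨K, hK⟩ := Set.mem_iUnion.1 hxU
  rw [hx K hK, fn, glue_eq _ hK]

/-- `weakDiv` is a chosen representative, so additivity is obtained through the elementwise
divergence. -/
theorem integral_weakDiv_add_mul (hd : 2 ≤ d) {σ τ : M.elems → PolyVec d}
    (hσ : MemHdiv Ω (fnVec M σ)) (hτ : MemHdiv Ω (fnVec M τ)) (v : M.elems → Poly d) :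
    ∫ x in Ω, weakDiv Ω (fnVec M (σ + τ)) x * fn M v x =
      (∫ x in Ω, weakDiv Ω (fnVec M σ) x * fn M v x) +
        ∫ x in Ω, weakDiv Ω (fnVec M τ) x * fn M v x := by
  rw [(integral_weakDiv_mul_eq_sum hd (memHdiv_add hσ hτ) v).2,
    (integral_weakDiv_mul_eq_sum hd hσ v).2, (integral_weakDiv_mul_eq_sum hd hτ v).2,
    ← Finset.sum_add_distrib]
  refine Finset.sum_congr rfl fun K _ => ?_
  have hi : ∀ p q : Poly d, IntegrableOn (fun x => ev p x * ev q x) (hull K.1) := fun p q =>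
    ((continuous_ev p).mul (continuous_ev q)).continuousOn.integrableOn_compact (M.isCompact_hull K)
  rw [← integral_add (hi _ _) (hi _ _)]
  simp only [Pi.add_apply, polyDiv_add, ev_add, mul_add]

variable (S : Skeleton M)

/-- Makes the jump an admissible test polynomial in the facet moments. -/
theorem exists_poly_jump {v : M.elems → Poly d} {s : ℕ} (hv : v ∈ DG M s) (F : M.facets) :
    ∃ φ : Poly d, φ.totalDegree ≤ s ∧ ∀ x, jump S v F x = ev φ x := by
  by_cases hF : M.IsInterior F
  · refine ⟨v (S.minus F) - v (S.plus F),
      (MvPolynomial.totalDegree_sub _ _).trans (max_le (hv _) (hv _)), fun x => ?_⟩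
    rw [jump, if_pos hF, ev_sub]
  · exact ⟨v (S.minus F), hv _, fun x => by rw [jump, if_neg hF]⟩

theorem evVec_grad_eq_zero {p : Poly d} (h : p.totalDegree ≤ 0) (x : Eu d) :
    evVec (grad p) x = 0 := by
  ext i
  simp [evVec, grad, pderiv_eq_zero h, ev]

variable {S} {A : M.elems → Matrix (Fin d) (Fin d) ℝ} {g : Eu d → ℝ} {u : M.elems → Poly d}

/-- The gradient of v has degree at most s - 1 ≤ j - 1, so it is an admissible test field. For s =
0, where no moments need be prescribed, it vanishes. -/
theorem IsAveragingFlux.interior_moment {s j : ℕ} (hs : s ≤ j) {τ : M.elems → PolyVec d}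
    (hτ : IsAveragingFlux S A g u j τ) {v : M.elems → Poly d} (hv : v ∈ DG M s) (K : M.elems) :
    ∫ x in hull K.1, inner ℝ (evVec (τ K) x) (evVec (grad (v K)) x) =
      -∫ x in hull K.1, inner ℝ (evVec (matMul (A K) (grad (u K))) x) (evVec (grad (v K)) x) := by
  rcases Nat.eq_zero_or_pos s with rfl | h
  · simp [evVec_grad_eq_zero (hv K)]
  · exact hτ.2.2.2 (by omega) K _ fun i =>
      (totalDegree_pderiv_le (hv K) i).trans (Nat.sub_le_sub_right hs 1)

/-- Averaging fluxes of different indices have the same divergence moments of low order. -/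
theorem IsAveragingFlux.integral_weakDiv_eq (hd : 2 ≤ d) {s j : ℕ} (hs : s ≤ j)
    {σ τ : M.elems → PolyVec d} (hσ : IsAveragingFlux S A g u s σ)
    (hτ : IsAveragingFlux S A g u j τ) {v : M.elems → Poly d} (hv : v ∈ DG M s) :
    ∫ x in Ω, weakDiv Ω (fnVec M σ) x * fn M v x =
      ∫ x in Ω, weakDiv Ω (fnVec M τ) x * fn M v x := by
  rw [S.integral_weakDiv_mul hd hσ.1.2, S.integral_weakDiv_mul hd hτ.1.2]
  congr 1
  · congr 1
    exact Finset.sum_congr rfl fun K _ => by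
      rw [hσ.interior_moment le_rfl hv, hτ.interior_moment hs hv]
  · refine Finset.sum_congr rfl fun F _ => ?_
    obtain ⟨φ, hφ, hj⟩ := exists_poly_jump S hv F
    simp_rw [hj]
    by_cases hF : F ∈ S.neumann
    · rw [hσ.2.2.1 F hF φ hφ, hτ.2.2.1 F hF φ (hφ.trans hs)]
    · rw [hσ.2.1 F hF φ hφ, hτ.2.1 F hF φ (hφ.trans hs)]

/-- S(w) is designed for this: in Green's formula its interior moments and Neumann traces vanish,
and the remaining facet terms are the jump form. -/
theorem IsJumpFlux.integral_weakDiv (hd : 2 ≤ d) {s : ℕ} {w : M.elems → Poly d}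
    {τ : M.elems → PolyVec d} (hτ : IsJumpFlux S A s w τ) {v : M.elems → Poly d}
    (hv : v ∈ DG M s) :
    ∫ x in Ω, weakDiv Ω (fnVec M τ) x * fn M v x = jumpForm S A w v := by
  classical
  obtain ⟨⟨hRT, hint, hN⟩, hF⟩ := hτ
  rw [S.integral_weakDiv_mul hd hRT.2, Finset.sum_eq_zero, neg_zero, zero_add, jumpForm,
    Finset.sum_filter]
  · refine Finset.sum_congr rfl fun F _ => ?_
    by_cases h : F ∈ S.neumann
    · rw [if_neg (not_not.2 h), facetMeasure,
        setIntegral_congr_fun (g := fun _ => (0 : ℝ)) (measurableSet_hull F.1), integral_zero]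
      intro x hx
      simp only [hN F h x hx, zero_mul]
    · rw [if_pos h, facetMeasure]
      refine setIntegral_congr_fun (measurableSet_hull F.1) fun x hx => ?_
      simp only [hF F h x hx]
  · intro K _
    rcases Nat.eq_zero_or_pos s with rfl | h
    · simp [evVec_grad_eq_zero (hv K)]
    · exact hint h K _ fun i => totalDegree_pderiv_le (hv K) i

theorem residual_eq (hd : 2 ≤ d) {f : Eu d → ℝ} (hf : MemLp f 2 (volume.restrict Ω))
    {σ : M.elems → PolyVec d} (hσ : MemHdiv Ω (fnVec M σ)) (v : M.elems → Poly d) :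
    residual M f σ v = (∫ x in Ω, f x * fn M v x) -
      ∫ x in Ω, weakDiv Ω (fnVec M σ) x * fn M v x := by
  have h1 : Integrable (fun x => f x * fn M v x) (volume.restrict Ω) :=
    hf.integrable_mul (memLp_fn v)
  rw [residual, ← integral_sub h1 (integral_weakDiv_mul_eq_sum hd hσ v).1]
  simp only [sub_mul]

/-- The normal component of a Raviart-Thomas field on a facet is a polynomial of degree `s`. -/
theorem exists_poly_normalTrace (hd : 2 ≤ d) {s : ℕ} {τ : M.elems → PolyVec d}
    (hτ : ∀ K, τ K ∈ RTLocal d s) (F : M.facets) : ∃ q : Poly d, q.totalDegree ≤ s ∧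
      ∀ x ∈ hull F.1, normalTrace S τ F x = ev q x := by
  classical
  obtain ⟨a, b, ha, hb, h⟩ := hτ (S.minus F)
  obtain ⟨y, hy⟩ : F.1.Nonempty := by
    rw [← Finset.card_pos, M.facet_card]
    omega
  obtain ⟨i, hi⟩ := M.exists_eq_erase (S.minus_sub F)
  have hn := S.isFaceNormal_outNormal hd hi
  rw [Skeleton.outNormal, if_pos rfl] at hn
  -- On F the product x·n_F is constant, so the part x b contributes only a multiple of b and the
  -- degree stays at most s.
  have hface : ∀ x ∈ hull F.1, inner ℝ (S.normal F) x = inner ℝ (S.normal F) y := by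
    intro x hx
    have hy' : y ∈ hull F.1 := subset_convexHull ℝ _ hy
    rw [hi, M.hull_erase] at hx hy'
    obtain ⟨-, c, -, h⟩ := hn
    have := h x y
    rw [hx.1, hy'.1, inner_sub_right] at this
    linarith
  refine ⟨(∑ l, MvPolynomial.C (S.normal F l) * a l) +
    MvPolynomial.C (inner ℝ (S.normal F) y) * b, ?_, fun x hx => ?_⟩
  · have hC : ∀ (c : ℝ) (p : Poly d), p.totalDegree ≤ s → (MvPolynomial.C c * p).totalDegree ≤ s :=
      fun c p hp => (MvPolynomial.totalDegree_mul _ _).trans (by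
        rwa [MvPolynomial.totalDegree_C, zero_add])
    exact (MvPolynomial.totalDegree_add _ _).trans (max_le
      (MvPolynomial.totalDegree_finsetSum_le fun l _ => hC _ _ (ha l)) (hC _ _ hb))
  · have h1 := hface x hx
    rw [ev_add, ev_sum, ev_mul, normalTrace, PiLp.inner_apply]
    have h2 : ev (MvPolynomial.C (inner ℝ (S.normal F) y) : Poly d) x =
        ∑ l, S.normal F l * x l := by
      rw [← h1, PiLp.inner_apply]
      simp [ev, mul_comm]
    rw [h2, Finset.sum_mul, ← Finset.sum_add_distrib]
    refine Finset.sum_congr rfl fun l _ => ?_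
    simp [evVec, h l, ev]
    ring

end FluxMoments

end EARM

end

/-! ### Equilibration of the corrected flux -/

theorem mainTheorem7 {d : ℕ} (hd : d = 2 ∨ d = 3) {Ω : Set (EARM.Eu d)}
    (hΩ : IsConnected Ω) (M : EARM.Mesh d Ω) (S : EARM.Skeleton M) (hD : S.dirichlet.Nonempty)
    (A : M.elems → Matrix (Fin d) (Fin d) ℝ) (hA : ∀ K, (A K).PosDef)
    (f g : EARM.Eu d → ℝ)
    (hf : MeasureTheory.MemLp f 2 (MeasureTheory.volume.restrict Ω))
    (hg : ∀ F ∈ S.neumann, MeasureTheory.MemLp g 2 (EARM.facetMeasure F.1))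
    (k s : ℕ) (hk : 1 ≤ k) (hs : s ≤ k - 1)
    -- the conforming finite element solution
    (u : M.elems → EARM.Poly d) (hu : EARM.IsCGSolution S A f g k u)
    -- its averaging fluxes of index `k - 1` and of index `s`
    (σk σs : M.elems → EARM.PolyVec d)
    (hσk : EARM.IsAveragingFlux S A g u (k - 1) σk)
    (hσs : EARM.IsAveragingFlux S A g u s σs)
    -- the solution of the correction problem, and its image under the map `S`
    (uΔ : M.elems → EARM.Poly d) (huΔ : EARM.IsCorrection S A f σk s uΔ)
    (σΔ : M.elems → EARM.PolyVec d) (hσΔ : EARM.IsJumpFlux S A s uΔ σΔ) :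
    σs + σΔ ∈ EARM.RTf S f g s ∧
      ∀ v ∈ EARM.DG M s,
        ∫ x in Ω, EARM.weakDiv Ω (EARM.fnVec M (σs + σΔ)) x * EARM.fn M v x =
          ∫ x in Ω, f x * EARM.fn M v x := by
  have hd2 : 2 ≤ d := by omega
  have hRT : σs + σΔ ∈ EARM.RT M s := EARM.RT_add hσs.1 hσΔ.1.1
  have hdiv : ∀ v ∈ EARM.DG M s,
      ∫ x in Ω, EARM.weakDiv Ω (EARM.fnVec M (σs + σΔ)) x * EARM.fn M v x =
        ∫ x in Ω, f x * EARM.fn M v x := by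
    intro v hv
    -- The divergence of `σs` tests like that of `σk`, and the correction adds (f - ∇·`σk`, v); the
    -- terms in `σk` cancel.
    rw [EARM.integral_weakDiv_add_mul hd2 hσs.1.2 hσΔ.1.1.2 v,
      hσs.integral_weakDiv_eq hd2 hs hσk hv, hσΔ.integral_weakDiv hd2 hv, huΔ.2 v hv,
      EARM.residual_eq hd2 hf hσk.1.2]
    ring
  have hp := EARM.weakDiv_ae_fn hd2 hRT.2
  -- The projection of f is witnessed by the elementwise divergence: it has the right degree, and
  -- `hdiv` gives its moments.
  refine ⟨⟨hRT, ⟨_, ⟨fun K => EARM.totalDegree_polyDiv_le (hRT.1 K), fun v hv => ?_⟩, hp⟩,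
    fun F hF => ?_⟩, hdiv⟩
  · rw [← hdiv v hv]
    refine MeasureTheory.integral_congr_ae ?_
    filter_upwards [hp] with x hx
    rw [hx]
  -- The projection of g is witnessed by the normal component of `σs`, since that of `σΔ` vanishes
  -- on Neumann facets.
  · obtain ⟨q, hq, hqF⟩ := EARM.exists_poly_normalTrace (S := S) hd2 hσs.1.1 F
    refine ⟨q, ⟨hq, fun φ hφ => ?_⟩, fun x hx => ?_⟩
    · rw [← hσs.2.2.1 F hF φ hφ, EARM.facetMeasure]
      refine MeasureTheory.setIntegral_congr_fun
        (EARM.measurableSet_hull F.1) fun x hx => ?_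
      simp only [hqF x hx]
    · have h := hσΔ.1.2.2 F hF x hx
      rw [← hqF x hx, ← add_zero (EARM.normalTrace S σs F x), ← h]
      simp only [EARM.normalTrace, Pi.add_apply, EARM.evVec_add, inner_add_left]
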